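/- Let $\mathbb H$ be the upper half plane, $q=e^{2\pi i\tau}$, $\zeta=e^{2\pi i z}$. For $k\in\mathbb Z$, a \emph{Jacobi form of index zero and weight $k$} (for the full Jacobi group $\Gamma_1^J=SL_2(\mathbb Z)\ltimes\mathbb Z^2$) is a meromorphic function $\chi$ on $\mathbb H\times\mathbb C$, all of whose poles lie on the divisor $\{z\in\mathbb Z\tau+\mathbb Z\}$, such that (i) $\chi\left(\frac{a\tau+b}{c\tau+d},\frac{z}{c\tau+d}\right)=(c\tau+d)^k\chi(\tau,z)$ for all $\begin{pmatrix}a&b\\c&d\end{pmatrix}\in SL_2(\mathbb Z)$; (ii) $\chi(\tau,z+m\tau+n)=\chi(\tau,z)$ for all $m,n\in\mathbb Z$; (iii) $\chi$ has an expansion $\chi(\tau,z)=\sum_{n\ge 0,\ r\in\mathbb Z}c_{n,r}q^n\zeta^r$, valid for $0<\operatorname{Im}z<\operatorname{Im}\tau$ and $\operatorname{Im}\tau$ sufficiently large. Let $J_{0,k}$ be the complex vector space of these forms. Put $E_n(\tau,z)=\sum_{(a,b)\in\mathbb Z^2}(z+a\tau+b)^{-n}$ for $n\ge 2$ and $e_2(\tau)=\sum_{(a,b)\in\mathbb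 Z^2\setminus\{(0,0)\}}(a\tau+b)^{-2}$, where the two series with exponent $2$ are summed by Eisenstein summation $\lim_{A\to\infty}\sum_{a=-A}^{A}\lim_{B\to\infty}\sum_{b=-B}^{B}$. \textbf{Proposition.} The functions $E_2-e_2$, $E_3$, $E_4$ are Jacobi forms of index zero and of weights $2,3,4$ respectively, and the algebra of Jacobi forms of index zero and weight $t\ge 2$ is generated by them. That is, for every integer $t\ge 2$ the space $J_{0,t}$ is spanned by the monomials $(E_2-e_2)^iE_3^jE_4^l$ with $i,j,l\ge 0$ and $2i+3j+4l=t$; and the $\mathbb C$-algebra (with unit) generated by $E_2-e_2,E_3,E_4$ is $\mathbb C+\sum_{t\ge 2}J_{0,t}$. -/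

import Mathlib

open UpperHalfPlane Filter Topology
open scoped MatrixGroups

noncomputable section

namespace JacobiIndexZero

/-- The complement in `ℍ × ℂ` of the divisor of lattice points `z ∈ ℤτ + ℤ`. -/
abbrev Dom : Type := {p : ℍ × ℂ // ∀ m n : ℤ, p.2 ≠ m * (p.1 : ℂ) + n}

lemma cd_ne_zero (γ : SL(2, ℤ)) (τ : ℍ) :
    ((γ 1 0 : ℤ) : ℂ) * (τ : ℂ) + ((γ 1 1 : ℤ) : ℂ) ≠ 0 := by
  have h := UpperHalfPlane.denom_ne_zero γ τ
  rwa [ModularGroup.denom_apply] at h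

/-- `[γ, 0] · (τ, z) = ((aτ + b) / (cτ + d), z / (cτ + d))`. -/
def modAct (γ : SL(2, ℤ)) (p : Dom) : Dom :=
  ⟨(γ • p.1.1, p.1.2 / ((γ 1 0 : ℤ) * (p.1.1 : ℂ) + (γ 1 1 : ℤ))), by
    intro m n h
    have hd := cd_ne_zero γ p.1.1
    refine p.2 (m * γ 0 0 + n * γ 1 0) (m * γ 0 1 + n * γ 1 1) ?_
    simp only [UpperHalfPlane.coe_specialLinearGroup_apply, algebraMap_int_eq, eq_intCast,
      Complex.ofReal_intCast] at h
    rw [div_eq_iff hd, add_mul, mul_assoc, div_mul_cancel₀ _ hd] at h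
    rw [h]
    push_cast
    ring⟩

/-- `[1, (m, n)] · (τ, z) = (τ, z + mτ + n)`. -/
def transAct (m n : ℤ) (p : Dom) : Dom :=
  ⟨(p.1.1, p.1.2 + m * (p.1.1 : ℂ) + n), by
    intro m' n' h
    refine p.2 (m' - m) (n' - n) ?_
    push_cast
    linear_combination h⟩

/-- The inclusion of the domain into `ℂ × ℂ`. -/
def incl (p : Dom) : ℂ × ℂ := ((p.1.1 : ℂ), p.1.2)

lemma incl_injective : Function.Injective incl := by
  intro p q h
  obtain ⟨h1, h2⟩ := Prod.mk.inj (show ((p.1.1 : ℂ), p.1.2) = ((q.1.1 : ℂ), q.1.2) from h)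
  exact Subtype.ext (Prod.ext (UpperHalfPlane.ext h1) h2)

/-- Extension by zero to `ℂ × ℂ`; used only to speak of differentiability at the points of the
(open) domain and of the behaviour near its boundary points `z = mτ + n`. -/
def ext0 (f : Dom → ℂ) : ℂ × ℂ → ℂ := Function.extend incl f 0

lemma ext0_add (f g : Dom → ℂ) : ext0 (f + g) = ext0 f + ext0 g := by
  have := Function.extend_add incl f g 0 0
  rwa [add_zero] at this

lemma ext0_smul (c : ℂ) (f : Dom → ℂ) : ext0 (c • f) = c • ext0 f := by
  have := Function.extend_smul c incl f 0
  rwa [smul_zero] at this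

lemma ext0_zero : ext0 0 = 0 := by
  simpa using ext0_smul 0 0

/-- `f` is a meromorphic function on `ℍ × ℂ` whose only poles lie on the lattice divisor
`z ∈ ℤτ + ℤ`: it is holomorphic off that divisor, and near every point of the component
`z = mτ + n` some power of `z - mτ - n` times `f` is holomorphic. -/
structure IsMeromorphicLatticePoles (f : Dom → ℂ) : Prop where
  holo : ∀ p : Dom, DifferentiableAt ℂ (ext0 f) (incl p)
  mero : ∀ (τ : ℍ) (m n : ℤ), ∃ (N : ℕ) (g : ℂ × ℂ → ℂ),
    ∀ᶠ x in 𝓝 (((τ : ℂ), m * (τ : ℂ) + n) : ℂ × ℂ), DifferentiableAt ℂ g x ∧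
      (x.2 ≠ m * x.1 + n → (x.2 - m * x.1 - n) ^ N * ext0 f x = g x)

/-- `f` has an expansion `∑ c(n,r) q ^ n ζ ^ r` (`n ≥ 0`, `r ∈ ℤ`, `q = exp (2πiτ)`,
`ζ = exp (2πiz)`) in the region `|q| < |ζ| < 1`, for `Im τ` sufficiently large. -/
def HasFourierExpansion (f : Dom → ℂ) : Prop :=
  ∃ (c : ℕ → ℤ → ℂ) (A : ℝ), ∀ p : Dom, A < p.1.1.im → 0 < p.1.2.im → p.1.2.im < p.1.1.im →
    HasSum (fun nr : ℕ × ℤ => c nr.1 nr.2 *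
      Complex.exp (2 * Real.pi * Complex.I * (p.1.1 : ℂ)) ^ nr.1 *
      Complex.exp (2 * Real.pi * Complex.I * p.1.2) ^ nr.2) (f p)

/-- Jacobi forms of index zero and weight `k` for the full Jacobi group `SL₂(ℤ) ⋉ ℤ²`. -/
structure IsJacobiForm (k : ℤ) (f : Dom → ℂ) : Prop where
  meromorphic : IsMeromorphicLatticePoles f
  fourier : HasFourierExpansion f
  modular : ∀ (γ : SL(2, ℤ)) (p : Dom),
    f (modAct γ p) = ((γ 1 0 : ℤ) * (p.1.1 : ℂ) + (γ 1 1 : ℤ)) ^ k * f p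
  elliptic : ∀ (m n : ℤ) (p : Dom), f (transAct m n p) = f p

/-- The space `J_{0,k}` of Jacobi forms of index zero and weight `k`. -/
def jacobiForms (k : ℤ) : Submodule ℂ (Dom → ℂ) where
  carrier := {f | IsJacobiForm k f}
  zero_mem' := by
    refine ⟨⟨fun p => ?_, fun τ m n => ⟨0, 0, ?_⟩⟩, ⟨0, 0, fun p _ _ _ => ?_⟩, ?_, ?_⟩
    · rw [ext0_zero]; exact differentiableAt_const 0
    · refine Eventually.of_forall fun x => ⟨differentiableAt_const 0, fun _ => ?_⟩
      simp [ext0_zero]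
    · simp [hasSum_zero]
    · simp
    · simp
  add_mem' := by
    rintro f g hf hg
    refine ⟨⟨fun p => ?_, fun τ m n => ?_⟩, ?_, fun γ p => ?_, fun m n p => ?_⟩
    · rw [ext0_add]
      exact (hf.meromorphic.holo p).add (hg.meromorphic.holo p)
    · obtain ⟨N, F, hF⟩ := hf.meromorphic.mero τ m n
      obtain ⟨M, G, hG⟩ := hg.meromorphic.mero τ m n
      refine ⟨N + M, fun x => (x.2 - m * x.1 - n) ^ M * F x + (x.2 - m * x.1 - n) ^ N * G x, ?_⟩
      filter_upwards [hF, hG] with x hx hy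
      have hl : DifferentiableAt ℂ (fun x : ℂ × ℂ => x.2 - m * x.1 - n) x := by fun_prop
      refine ⟨((hl.pow M).mul hx.1).add ((hl.pow N).mul hy.1), fun h => ?_⟩
      rw [ext0_add, Pi.add_apply, ← hx.2 h, ← hy.2 h]
      ring
    · obtain ⟨c, A, hc⟩ := hf.fourier
      obtain ⟨d, B, hd⟩ := hg.fourier
      refine ⟨c + d, max A B, fun p h1 h2 h3 => ?_⟩
      have := (hc p (lt_of_le_of_lt (le_max_left _ _) h1) h2 h3).add
        (hd p (lt_of_le_of_lt (le_max_right _ _) h1) h2 h3)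
      simpa only [Pi.add_apply, add_mul] using this
    · simp only [Pi.add_apply, hf.modular γ p, hg.modular γ p, mul_add]
    · simp only [Pi.add_apply, hf.elliptic m n p, hg.elliptic m n p]
  smul_mem' := by
    rintro a f hf
    refine ⟨⟨fun p => ?_, fun τ m n => ?_⟩, ?_, fun γ p => ?_, fun m n p => ?_⟩
    · rw [ext0_smul]
      exact (hf.meromorphic.holo p).const_smul a
    · obtain ⟨N, F, hF⟩ := hf.meromorphic.mero τ m n
      refine ⟨N, a • F, ?_⟩
      filter_upwards [hF] with x hx
      refine ⟨hx.1.const_smul a, fun h => ?_⟩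
      rw [ext0_smul, Pi.smul_apply, Pi.smul_apply, ← hx.2 h, smul_eq_mul, smul_eq_mul]
      ring
    · obtain ⟨c, A, hc⟩ := hf.fourier
      refine ⟨a • c, A, fun p h1 h2 h3 => ?_⟩
      have := (hc p h1 h2 h3).mul_left a
      simpa only [Pi.smul_apply, smul_eq_mul, mul_assoc] using this
    · simp only [Pi.smul_apply, smul_eq_mul, hf.modular γ p]
      ring
    · simp only [Pi.smul_apply, hf.elliptic m n p]

/-- `E_n(τ, z) = ∑_{(a,b) ∈ ℤ²} 1 / (z + aτ + b) ^ n`, as an absolutely convergent sum (`n ≥ 3`). -/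
def E (n : ℕ) (p : Dom) : ℂ :=
  ∑' ab : ℤ × ℤ, 1 / (p.1.2 + ab.1 * (p.1.1 : ℂ) + ab.2) ^ n

/-- `E_2(τ, z)`: the series `∑ 1 / (z + aτ + b) ^ 2` with Eisenstein summation, i.e.
`lim_{A → ∞} ∑_{a = -A}^{A} lim_{B → ∞} ∑_{b = -B}^{B}`. -/
def E2 (p : Dom) : ℂ :=
  ∑'[SummationFilter.symmetricIcc ℤ] a : ℤ, ∑'[SummationFilter.symmetricIcc ℤ] b : ℤ,
    1 / (p.1.2 + a * (p.1.1 : ℂ) + b) ^ 2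

/-- `e_2(τ) = ∑_{(a,b) ≠ (0,0)} 1 / (aτ + b) ^ 2` with Eisenstein summation (Mathlib's `G2`; the
term `(0,0)` of that series is `0`), as a function of `(τ, z)`. -/
def e2 (p : Dom) : ℂ := EisensteinSeries.G2 p.1.1

end JacobiIndexZero

end

/-!
# Jacobi forms of index zero

Put `℘ = E_2 - e_2`. The Eisenstein summations of `E_2` and `e_2` differ by the absolutely
convergent series `∑ (1 / (z + ω) ^ 2 - 1 / ω ^ 2)` (`E2_sub_e2`), so `℘` is the Weierstrass
function of the lattice `ℤτ + ℤ`, and modularity and periodicity follow by permuting the lattice.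
The Fourier expansions of `℘`, `E_3`, `E_4` come from the Lipschitz formula applied to the inner
sums (`hasFourierExpansion_of_hasSum_tsum`).

That these forms generate is proved by induction on the order `N` of the pole along `z = 0`, which
is bounded uniformly in `τ` because `ℍ` is connected
(`IsMeromorphicLatticePoles.exists_forall_poleLE`). Let `f` be a Jacobi form of weight `k`.

* The coefficient of `z ^ (-N)` is a modular form of weight `k - N` (`leadForm`). Its boundedness at
  `i∞` is where the Fourier expansion of `f` enters: the expansion bounds `f` on a line `Im z = y`
  and, by parity in `z`, on `Im z = -y`, uniformly in `τ`; the function `(1 - ζ) ^ N * f` is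
  holomorphic in the strip between the two lines, and the Phragmén–Lindelöf principle carries the
  bound to its value at `z = 0` (`norm_lead_le`).
* For `N ≥ 2` write `N = 2 i + 3 j`. Then `℘ ^ i E_3 ^ j` has leading coefficient `1`, and
  subtracting its product with the modular form lowers `N`.
* The case `N = 1` reduces to `N = 0`, as the residue of an elliptic function with a single simple
  pole vanishes (`lead_one_eq_zero`), and for `N = 0` the form `f` is a modular form in `τ` alone by
  Liouville's theorem (`PoleLE.eq_lead_zero`).

It remains to see that modular forms are polynomials in `℘`, `E_3`, `E_4`
(`modularForm_mem_monomialSpan`). They are polynomials in the Eisenstein series `E₄` and `E₆`, and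
those occur as the coefficients in the differential equation of `℘`: since `℘'' = 6 E_4` one has
`℘ ^ 2 - E_4 = g₂ / 12` (`wp_sq_sub_E_four`), and since `℘' = -2 E_3` the equation of first order
expresses `g₃` (`g₃_eq`).
-/

namespace JacobiIndexZero

variable {f g : Dom → ℂ} {N M : ℕ} {τ : ℍ} {k l : ℤ}

/-! ### Extension by zero off the domain -/

lemma ext0_incl (f : Dom → ℂ) (p : Dom) : ext0 f (incl p) = f p :=
  incl_injective.extend_apply _ _ _

lemma mem_range_incl {x : ℂ × ℂ} :
    x ∈ Set.range incl ↔ 0 < x.1.im ∧ ∀ m n : ℤ, x.2 ≠ m * x.1 + n := by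
  constructor
  · rintro ⟨p, rfl⟩
    exact ⟨p.1.1.im_pos, p.2⟩
  · rintro ⟨h, h'⟩
    exact ⟨⟨(⟨x.1, h⟩, x.2), h'⟩, rfl⟩

lemma ext0_of_notMem (f : Dom → ℂ) {x : ℂ × ℂ} (hx : x ∉ Set.range incl) : ext0 f x = 0 :=
  Function.extend_apply' _ _ _ hx

lemma ext0_mul (f g : Dom → ℂ) : ext0 (f * g) = ext0 f * ext0 g := by
  have := Function.extend_mul incl f g 0 0
  rwa [mul_zero] at this

lemma ext0_sub (f g : Dom → ℂ) : ext0 (f - g) = ext0 f - ext0 g := by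
  have := Function.extend_sub incl f g 0 0
  rwa [sub_zero] at this

lemma ext0_add_lattice {f : Dom → ℂ} (hf : ∀ (m n : ℤ) (p : Dom), f (transAct m n p) = f p)
    (m n : ℤ) (τ z : ℂ) : ext0 f (τ, z + (m * τ + n)) = ext0 f (τ, z) := by
  by_cases h : (τ, z) ∈ Set.range incl
  · obtain ⟨p, hp⟩ := h
    have h2 : incl (transAct m n p) = (τ, z + (m * τ + n)) := by
      simp only [incl, Prod.mk.injEq] at hp ⊢
      simp only [transAct]
      exact ⟨hp.1, by rw [hp.1, hp.2]; ring⟩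
    rw [← h2, ← hp, ext0_incl, ext0_incl, hf]
  · rw [ext0_of_notMem _ h, ext0_of_notMem]
    rw [mem_range_incl] at h ⊢
    rintro ⟨h1, h2⟩
    refine h ⟨h1, fun a b hab => h2 (a + m) (b + n) ?_⟩
    simp only at hab
    simp only [hab]
    push_cast
    ring

lemma ext0_modAct {f : Dom → ℂ} {k : ℤ} (hf : ∀ (γ : SL(2, ℤ)) (p : Dom),
      f (modAct γ p) = ((γ 1 0 : ℤ) * (p.1.1 : ℂ) + (γ 1 1 : ℤ)) ^ k * f p)
    (γ : SL(2, ℤ)) (τ : ℍ) (z : ℂ) :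
    ext0 f (((γ • τ : ℍ) : ℂ), z / ((γ 1 0 : ℤ) * (τ : ℂ) + (γ 1 1 : ℤ))) =
      ((γ 1 0 : ℤ) * (τ : ℂ) + (γ 1 1 : ℤ)) ^ k * ext0 f ((τ : ℂ), z) := by
  by_cases h : ((τ : ℂ), z) ∈ Set.range incl
  · obtain ⟨p, hp⟩ := h
    have h1 : p.1.1 = τ := UpperHalfPlane.ext (congrArg Prod.fst hp)
    have h2 : p.1.2 = z := congrArg Prod.snd hp
    have h3 : incl (modAct γ p) =
        (((γ • τ : ℍ) : ℂ), z / ((γ 1 0 : ℤ) * (τ : ℂ) + (γ 1 1 : ℤ))) := by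
      simp only [incl, modAct, h1, h2]
    rw [← h3, ← hp, ext0_incl, ext0_incl, hf, h1]
  · rw [ext0_of_notMem _ h, ext0_of_notMem, mul_zero]
    rw [mem_range_incl] at h ⊢
    rintro ⟨-, h2⟩
    refine h ⟨τ.im_pos, fun m n hmn => h2 (m * γ 1 1 - n * γ 1 0) (n * γ 0 0 - m * γ 0 1) ?_⟩
    have hd := cd_ne_zero γ τ
    have hdet : ((γ 0 0 : ℤ) : ℂ) * ((γ 1 1 : ℤ) : ℂ) -
        ((γ 0 1 : ℤ) : ℂ) * ((γ 1 0 : ℤ) : ℂ) = 1 := by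
      have := γ.det_coe
      rw [Matrix.det_fin_two] at this
      exact_mod_cast this
    simp only at hmn
    simp only [UpperHalfPlane.coe_specialLinearGroup_apply, algebraMap_int_eq, eq_intCast,
      Complex.ofReal_intCast]
    rw [div_eq_iff hd, add_mul, mul_assoc, div_mul_cancel₀ _ hd, hmn]
    push_cast
    linear_combination (-(m * (τ : ℂ)) - n) * hdet

/-- The modularity under `-1 ∈ SL₂(ℤ)`: a form of weight `k` has the parity of `k` in `z`. -/
lemma ext0_neg {f : Dom → ℂ} {k : ℤ} (hf : ∀ (γ : SL(2, ℤ)) (p : Dom),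
      f (modAct γ p) = ((γ 1 0 : ℤ) * (p.1.1 : ℂ) + (γ 1 1 : ℤ)) ^ k * f p)
    (τ : ℍ) (z : ℂ) : ext0 f ((τ : ℂ), -z) = (-1) ^ k * ext0 f ((τ : ℂ), z) := by
  simpa [div_neg] using ext0_modAct hf (-1) τ z

/-- A point `(τ, z)` with `z = aτ + b`, `a b : ℝ`, lies in the domain iff `(a, b)` is not an
integral point; this exhibits the domain as an open set. -/
lemma isOpen_range_incl : IsOpen (Set.range incl) := by
  have h1 : IsOpen {x : ℂ × ℂ | 0 < x.1.im} :=
    isOpen_lt continuous_const (Complex.continuous_im.comp continuous_fst)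
  let φ : ℂ × ℂ → ℝ × ℝ := fun x => (x.2.im / x.1.im, x.2.re - x.2.im / x.1.im * x.1.re)
  have h2 : ContinuousOn φ {x : ℂ × ℂ | 0 < x.1.im} := by
    have h : ContinuousOn (fun x : ℂ × ℂ => x.2.im / x.1.im) {x : ℂ × ℂ | 0 < x.1.im} :=
      ContinuousOn.div (by fun_prop) (by fun_prop) fun x hx => ne_of_gt hx
    exact h.prodMk ((by fun_prop : Continuous fun x : ℂ × ℂ => x.2.re).continuousOn.sub
      (h.mul (by fun_prop)))
  have h3 : IsClosed ((Set.range ((↑) : ℤ → ℝ)) ×ˢ (Set.range ((↑) : ℤ → ℝ))) :=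
    Int.isClosedEmbedding_coe_real.isClosed_range.prod Int.isClosedEmbedding_coe_real.isClosed_range
  convert h2.isOpen_inter_preimage h1 h3.isOpen_compl using 1
  ext x
  rw [mem_range_incl]
  refine and_congr_right fun hx => ?_
  simp only [Set.mem_preimage, Set.mem_compl_iff, Set.mem_prod, not_and, φ]
  have hx' : x.1.im ≠ 0 := ne_of_gt hx
  constructor
  · rintro h ⟨m, hm⟩ ⟨n, hn⟩
    refine h m n (Complex.ext ?_ ?_)
    · simp [hm, hn]
    · simp [hm, div_mul_cancel₀ _ hx']
  · intro h m n hmn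
    have him : x.2.im / x.1.im = m := by
      rw [hmn]; simp [hx']
    exact h ⟨m, him.symm⟩ ⟨n, by rw [him, hmn]; simp⟩

lemma ext0_eventuallyEq {f : Dom → ℂ} {F : ℂ × ℂ → ℂ} (h : ∀ p, f p = F (incl p)) (p : Dom) :
    ext0 f =ᶠ[𝓝 (incl p)] F := by
  filter_upwards [isOpen_range_incl.mem_nhds ⟨p, rfl⟩]
  rintro _ ⟨q, rfl⟩
  rw [ext0_incl, h]

/-- Near a point `(τ, 0)` the only lattice points are those with `z = 0`. -/
lemma eventually_mem_range_incl (τ : ℍ) :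
    ∀ᶠ x in 𝓝 (((τ : ℂ), 0) : ℂ × ℂ), 0 < x.1.im ∧ (x.2 ≠ 0 → x ∈ Set.range incl) := by
  have h1 : ∀ᶠ x in 𝓝 (((τ : ℂ), 0) : ℂ × ℂ), 0 < x.1.im :=
    (isOpen_lt continuous_const (Complex.continuous_im.comp continuous_fst)).mem_nhds τ.im_pos
  have h2 : ∀ᶠ x in 𝓝 (((τ : ℂ), 0) : ℂ × ℂ), ‖x.2‖ < 1 :=
    (isOpen_lt (continuous_norm.comp continuous_snd) continuous_const).mem_nhds (by simp)
  have h3 : ∀ᶠ x in 𝓝 (((τ : ℂ), 0) : ℂ × ℂ), ‖x.2‖ < x.1.im :=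
    (isOpen_lt (continuous_norm.comp continuous_snd)
      (Complex.continuous_im.comp continuous_fst)).mem_nhds (by simpa using τ.im_pos)
  filter_upwards [h1, h2, h3] with x h1 h2 h3
  refine ⟨h1, fun h0 => mem_range_incl.2 ⟨h1, fun m n hmn => h0 ?_⟩⟩
  have hm : m = 0 := by
    have := (Complex.abs_im_le_norm x.2).trans_lt h3
    rw [hmn] at this
    simp only [Complex.add_im, Complex.mul_im, Complex.intCast_re, Complex.intCast_im, zero_mul,
      add_zero, abs_mul, abs_of_pos h1] at this
    have h4 : |(m : ℝ)| < 1 := by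
      by_contra hc
      exact absurd this (not_lt.2 (le_mul_of_one_le_left h1.le (not_lt.1 hc)))
    exact Int.abs_lt_one_iff.1 (by exact_mod_cast h4)
  subst hm
  have hn : n = 0 := by
    rw [hmn] at h2
    simp only [Int.cast_zero, zero_mul, zero_add, Complex.norm_intCast] at h2
    exact Int.abs_lt_one_iff.1 (by exact_mod_cast h2)
  simp [hmn, hn]

/-! ### Two facts on holomorphic functions -/

/-- A series of holomorphic functions of several variables with locally a summable bound is
holomorphic: by the Schwarz lemma a bound on the terms bounds their derivatives. -/
theorem differentiableAt_tsum_of_eventually {ι V W : Type*} [NormedAddCommGroup V]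
    [NormedSpace ℂ V] [NormedAddCommGroup W] [NormedSpace ℂ W] [CompleteSpace W]
    {f : ι → V → W} {u : ι → ℝ} {x : V} (hu : Summable u)
    (h : ∀ᶠ y in 𝓝 x, ∀ i, DifferentiableAt ℂ (f i) y ∧ ‖f i y‖ ≤ u i) :
    DifferentiableAt ℂ (fun y => ∑' i, f i y) x := by
  obtain ⟨r, hr, hrs⟩ := Metric.eventually_nhds_iff_ball.1 h
  have key : ∀ i, ∀ y ∈ Metric.ball x (r / 2), ‖fderiv ℂ (f i) y‖ ≤ 2 * u i / (r / 2) := by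
    intro i y hy
    have hsub : Metric.ball y (r / 2) ⊆ Metric.ball x r := by
      refine Metric.ball_subset_ball' ?_
      rw [Metric.mem_ball] at hy
      linarith
    refine Complex.norm_fderiv_le_div_of_mapsTo_ball
      (fun z hz => (hrs z (hsub hz) i).1.differentiableWithinAt) (fun z hz => ?_) (by positivity)
    rw [mem_closedBall_iff_norm]
    refine (norm_sub_le _ _).trans ?_
    have h1 := (hrs z (hsub hz) i).2
    have h2 := (hrs y (hsub (Metric.mem_ball_self (by positivity))) i).2
    linarith
  have hx : x ∈ Metric.ball x (r / 2) := Metric.mem_ball_self (by positivity)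
  have hsub : Metric.ball x (r / 2) ⊆ Metric.ball x r := Metric.ball_subset_ball (by linarith)
  refine (hasFDerivAt_tsum_of_isPreconnected (𝕜 := ℂ) (u := fun i => 2 * u i / (r / 2))
    ((hu.mul_left 2).div_const _)
    Metric.isOpen_ball (convex_ball x (r / 2)).isPreconnected
    (fun i y hy => (hrs y (hsub hy) i).1.hasFDerivAt) key hx
    (Summable.of_norm_bounded hu fun i => (hrs x (hsub hx) i).2) hx).differentiableAt

open Classical in
/-- Removing the singularities of a periodic function at all points of its group of periods. -/
theorem differentiableAt_ite_mem_of_tendsto {Λ : AddSubgroup ℂ} {G : ℂ → ℂ} {c : ℂ}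
    (hper : ∀ l ∈ Λ, ∀ z, G (z + l) = G z)
    (h0 : ∀ᶠ z in 𝓝[≠] 0, z ∉ Λ ∧ DifferentiableAt ℂ G z)
    (hlim : Tendsto G (𝓝[≠] 0) (𝓝 c)) {l : ℂ} (hl : l ∈ Λ) :
    DifferentiableAt ℂ (fun z => if z ∈ Λ then c else G z) l := by
  set F : ℂ → ℂ := fun z => if z ∈ Λ then c else G z with hF
  have hFG : ∀ᶠ z in 𝓝[≠] 0, F z = G z := h0.mono fun z hz => if_neg hz.1
  have hd0 : DifferentiableAt ℂ F 0 := by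
    refine (Complex.analyticAt_of_differentiable_on_punctured_nhds_of_continuousAt ?_
      ?_).differentiableAt
    · have := eventually_eventually_nhdsWithin.2 hFG
      filter_upwards [this, h0, self_mem_nhdsWithin] with z hz hz' hne
      refine hz'.2.congr_of_eventuallyEq ?_
      rwa [nhdsWithin_eq_nhds.2 (isOpen_compl_singleton.mem_nhds hne)] at hz
    · rw [continuousAt_iff_punctured_nhds]
      have : F 0 = c := if_pos Λ.zero_mem
      rw [this]
      exact hlim.congr' (hFG.mono fun z hz => hz.symm)
  have hFper : F = fun z => F (z - l) := by
    funext z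
    simp only [hF]
    rw [sub_eq_add_neg, Λ.add_mem_cancel_right (Λ.neg_mem hl), ← sub_eq_add_neg]
    congr 1
    rw [← hper l hl (z - l), sub_add_cancel]
  rw [hFper]
  exact (differentiableAt_comp_sub_const (a := l)).2 (by rwa [sub_self])

/-! ### The pole order along `z = 0` and the leading coefficient -/

/-- Near `(τ, 0)` the pole of `f` along the component `z = 0` of the divisor has order at most `N`:
the function `z ^ N * f` is bounded there. -/
def PoleLE (N : ℕ) (f : Dom → ℂ) (τ : ℍ) : Prop :=
  (fun x : ℂ × ℂ => x.2 ^ N * ext0 f x) =O[𝓝 ((τ : ℂ), 0)] (fun _ => (1 : ℝ))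

/-- The coefficient of `z ^ (-N)` in the Laurent expansion of `f (w, ·)` at `z = 0`, for a function
with a pole of order at most `N` there: the limit of `z ^ N * f (w, z)` as `z → 0`. -/
noncomputable def lead (N : ℕ) (f : Dom → ℂ) (w : ℂ) : ℂ :=
  limUnder (𝓝[≠] 0) fun z => z ^ N * ext0 f (w, z)

lemma notMem_range_incl_zero (w : ℂ) : (w, (0 : ℂ)) ∉ Set.range incl := by
  rw [mem_range_incl]
  rintro ⟨-, h⟩
  exact h 0 0 (by simp)

lemma lead_eq {w c : ℂ} (h : Tendsto (fun z => z ^ N * ext0 f (w, z)) (𝓝[≠] 0) (𝓝 c)) :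
    lead N f w = c :=
  h.limUnder_eq

/-- By the Schwarz lemma `z ^ N * f (w, z)` tends to its limit uniformly in `w`. -/
lemma PoleLE.exists_bound (hf : ∀ p : Dom, DifferentiableAt ℂ (ext0 f) (incl p))
    (h : PoleLE N f τ) : ∃ K r : ℝ, 0 < r ∧ ∀ w ∈ Metric.ball (τ : ℂ) r, 0 < w.im ∧
      ∀ z ∈ Metric.ball (0 : ℂ) r, z ≠ 0 → (w, z) ∈ Set.range incl ∧
        ‖z ^ N * ext0 f (w, z) - lead N f w‖ ≤ K * ‖z‖ := by
  obtain ⟨C, hC⟩ := h.bound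
  obtain ⟨r, hr, hb⟩ := Metric.eventually_nhds_iff_ball.1 (hC.and (eventually_mem_range_incl τ))
  have hmem : ∀ w ∈ Metric.ball (τ : ℂ) r, ∀ z ∈ Metric.ball (0 : ℂ) r,
      (w, z) ∈ Metric.ball ((τ : ℂ), (0 : ℂ)) r := by
    intro w hw z hz
    rw [← ball_prod_same]
    exact ⟨hw, hz⟩
  refine ⟨(C + C) / r, r, hr, fun w hw => ⟨(hb _ (hmem w hw 0 (Metric.mem_ball_self hr))).2.1,
    fun z hz hz0 => ⟨(hb _ (hmem w hw z hz)).2.2 hz0, ?_⟩⟩⟩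
  set G : ℂ → ℂ := fun z => z ^ N * ext0 f (w, z) with hG
  have hGC : ∀ z ∈ Metric.ball (0 : ℂ) r, ‖G z‖ ≤ C := fun z hz => by
    simpa [hG] using (hb _ (hmem w hw z hz)).1
  have hGd : DifferentiableOn ℂ G (Metric.ball 0 r \ {0}) := by
    intro z hz
    obtain ⟨p, hp⟩ := (hb _ (hmem w hw z hz.1)).2.2 hz.2
    have h1 : DifferentiableAt ℂ (ext0 f) (w, z) := hp ▸ hf p
    have h2 : DifferentiableAt ℂ (fun z => ext0 f (w, z)) z :=
      h1.comp z ((differentiableAt_const w).prodMk differentiableAt_id)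
    exact (DifferentiableAt.mul (by fun_prop) h2).differentiableWithinAt
  have hnhds : Metric.ball (0 : ℂ) r ∈ 𝓝 (0 : ℂ) := Metric.ball_mem_nhds _ hr
  have hbdd : BddAbove (norm ∘ G '' (Metric.ball 0 r \ {0})) := by
    refine ⟨C, ?_⟩
    rintro _ ⟨z, hz, rfl⟩
    exact hGC z hz.1
  have hd := Complex.differentiableOn_update_limUnder_of_bddAbove hnhds hGd hbdd
  set H := Function.update G 0 (limUnder (𝓝[≠] 0) G) with hH
  have hlim : Tendsto G (𝓝[≠] 0) (𝓝 (lead N f w)) :=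
    continuousAt_update_same.1 (hd.continuousOn.continuousAt hnhds)
  have hlC : ‖lead N f w‖ ≤ C := by
    refine le_of_tendsto hlim.norm ?_
    filter_upwards [nhdsWithin_le_nhds hnhds] with z hz using hGC z hz
  have hH0 : H 0 = lead N f w := Function.update_self ..
  have hHz : ∀ z ≠ 0, H z = G z := fun z hz => Function.update_of_ne hz ..
  have hmaps : Set.MapsTo H (Metric.ball 0 r) (Metric.closedBall (H 0) (C + C)) := by
    intro z hz
    rw [mem_closedBall_iff_norm]
    refine (norm_sub_le _ _).trans (add_le_add ?_ (hH0 ▸ hlC))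
    rcases eq_or_ne z 0 with rfl | h
    · rwa [hH0]
    · rw [hHz z h]
      exact hGC z hz
  have := Complex.dist_le_div_mul_dist_of_mapsTo_ball hd hmaps hz
  rwa [hHz z hz0, hH0, dist_eq_norm, dist_zero_right] at this

lemma tendsto_of_norm_sub_le {G : ℂ → ℂ} {c : ℂ} {K r : ℝ} (hr : 0 < r)
    (h : ∀ z ∈ Metric.ball (0 : ℂ) r, z ≠ 0 → ‖G z - c‖ ≤ K * ‖z‖) :
    Tendsto G (𝓝[≠] 0) (𝓝 c) := by
  rw [tendsto_iff_norm_sub_tendsto_zero]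
  have h0 : Tendsto (fun z : ℂ => K * ‖z‖) (𝓝[≠] 0) (𝓝 0) := by
    have : Continuous fun z : ℂ => K * ‖z‖ := by fun_prop
    simpa using (this.tendsto 0).mono_left nhdsWithin_le_nhds
  refine squeeze_zero' (Eventually.of_forall fun _ => norm_nonneg _) ?_ h0
  filter_upwards [nhdsWithin_le_nhds (Metric.ball_mem_nhds (0 : ℂ) hr), self_mem_nhdsWithin]
    with z hz hz0 using h z hz hz0

lemma PoleLE.tendsto_lead (hf : ∀ p : Dom, DifferentiableAt ℂ (ext0 f) (incl p))
    (h : PoleLE N f τ) :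
    Tendsto (fun z => z ^ N * ext0 f ((τ : ℂ), z)) (𝓝[≠] 0) (𝓝 (lead N f τ)) := by
  obtain ⟨K, r, hr, hb⟩ := h.exists_bound hf
  exact tendsto_of_norm_sub_le hr fun z hz hz0 =>
    ((hb τ (Metric.mem_ball_self hr)).2 z hz hz0).2

/-- The leading coefficient is holomorphic in `τ`, as a uniform limit. -/
lemma PoleLE.exists_differentiableOn_lead (hf : ∀ p : Dom, DifferentiableAt ℂ (ext0 f) (incl p))
    (h : PoleLE N f τ) :
    ∃ r : ℝ, 0 < r ∧ DifferentiableOn ℂ (lead N f) (Metric.ball (τ : ℂ) r) := by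
  obtain ⟨K, r, hr, hb⟩ := h.exists_bound hf
  refine ⟨r, hr, ?_⟩
  have hev : ∀ᶠ z in 𝓝[≠] (0 : ℂ), z ∈ Metric.ball (0 : ℂ) r ∧ z ≠ 0 :=
    inter_mem (nhdsWithin_le_nhds (Metric.ball_mem_nhds (0 : ℂ) hr)) self_mem_nhdsWithin
  have hu : TendstoUniformlyOn (fun (z : ℂ) (w : ℂ) => z ^ N * ext0 f (w, z)) (lead N f)
      (𝓝[≠] 0) (Metric.ball (τ : ℂ) r) := by
    rw [Metric.tendstoUniformlyOn_iff]
    intro ε hε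
    have h0 : Tendsto (fun z : ℂ => K * ‖z‖) (𝓝[≠] 0) (𝓝 0) := by
      have : Continuous fun z : ℂ => K * ‖z‖ := by fun_prop
      simpa using (this.tendsto 0).mono_left nhdsWithin_le_nhds
    filter_upwards [hev, h0.eventually (gt_mem_nhds hε)] with z hz hzε w hw
    rw [dist_comm, dist_eq_norm]
    exact (((hb w hw).2 z hz.1 hz.2).2).trans_lt hzε
  refine hu.tendstoLocallyUniformlyOn.differentiableOn ?_ Metric.isOpen_ball
  filter_upwards [hev] with z hz w hw
  obtain ⟨p, hp⟩ := ((hb w hw).2 z hz.1 hz.2).1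
  have h1 : DifferentiableAt ℂ (ext0 f) (w, z) := hp ▸ hf p
  have h2 : DifferentiableAt ℂ (fun w => ext0 f (w, z)) w :=
    h1.comp w (differentiableAt_id.prodMk (differentiableAt_const z))
  exact (h2.const_mul _).differentiableWithinAt

/-- If the leading coefficient vanishes, the order of the pole drops. -/
lemma PoleLE.of_lead_eq_zero (hf : ∀ p : Dom, DifferentiableAt ℂ (ext0 f) (incl p))
    (h : PoleLE (N + 1) f τ) (h0 : ∀ᶠ w in 𝓝 (τ : ℂ), lead (N + 1) f w = 0) : PoleLE N f τ := by
  obtain ⟨K, r, hr, hb⟩ := h.exists_bound hf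
  refine Asymptotics.IsBigO.of_bound |K| ?_
  have h1 : ∀ᶠ x in 𝓝 (((τ : ℂ), 0) : ℂ × ℂ), lead (N + 1) f x.1 = 0 :=
    (continuous_fst.tendsto (((τ : ℂ), 0) : ℂ × ℂ)).eventually h0
  filter_upwards [h1, Metric.ball_mem_nhds (((τ : ℂ), 0) : ℂ × ℂ) hr] with ⟨w, z⟩ hw hx
  rw [← ball_prod_same] at hx
  rcases eq_or_ne z 0 with rfl | hz
  · simp [ext0_of_notMem f (notMem_range_incl_zero w)]
  · have := ((hb w hx.1).2 z hx.2 hz).2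
    simp only at hw
    rw [hw, sub_zero, pow_succ', mul_assoc, norm_mul, mul_comm] at this
    simpa using (le_of_mul_le_mul_right this (norm_pos_iff.2 hz)).trans (le_abs_self K)

lemma PoleLE.mono (h : PoleLE N f τ) (hNM : N ≤ M) : PoleLE M f τ := by
  obtain ⟨k, rfl⟩ := Nat.exists_eq_add_of_le hNM
  have h1 : (fun x : ℂ × ℂ => x.2 ^ k) =O[𝓝 ((τ : ℂ), 0)] (fun _ => (1 : ℝ)) :=
    (by fun_prop : Continuous fun x : ℂ × ℂ => x.2 ^ k).continuousAt.isBigO_one ℝ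
  have := h1.mul h
  simp only [mul_one] at this
  exact this.congr_left fun x => by ring

lemma PoleLE.mul (hf : PoleLE N f τ) (hg : PoleLE M g τ) : PoleLE (N + M) (f * g) τ := by
  have := Asymptotics.IsBigO.mul hf hg
  simp only [mul_one] at this
  exact this.congr_left fun x => by rw [ext0_mul, Pi.mul_apply]; ring

lemma PoleLE.sub (hf : PoleLE N f τ) (hg : PoleLE N g τ) : PoleLE N (f - g) τ :=
  (Asymptotics.IsBigO.sub hf hg).congr_left fun x => by rw [ext0_sub, Pi.sub_apply]; ring

lemma PoleLE.eventually (h : PoleLE N f τ) : ∀ᶠ w in 𝓝 τ, PoleLE N f w := by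
  obtain ⟨C, hC⟩ := h.bound
  have h1 : Tendsto (fun w : ℍ => ((w : ℂ), (0 : ℂ))) (𝓝 τ) (𝓝 ((τ : ℂ), 0)) :=
    (UpperHalfPlane.continuous_coe.prodMk continuous_const).tendsto τ
  exact (h1.eventually (eventually_eventually_nhds.2 hC)).mono fun w hw =>
    Asymptotics.IsBigO.of_bound C hw

lemma IsMeromorphicLatticePoles.exists_poleLE (hf : IsMeromorphicLatticePoles f) (τ : ℍ) :
    ∃ N, PoleLE N f τ := by
  obtain ⟨N, G, hG⟩ := hf.mero τ 0 0
  simp only [Int.cast_zero, zero_mul, add_zero, sub_zero] at hG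
  refine ⟨N, ?_⟩
  have hc : ContinuousAt G ((τ : ℂ), 0) := hG.self_of_nhds.1.continuousAt
  refine Asymptotics.IsBigO.trans (Asymptotics.IsBigO.of_bound 1 ?_) (hc.isBigO_one ℝ)
  filter_upwards [hG] with ⟨w, z⟩ hx
  rcases eq_or_ne z 0 with rfl | hz
  · simp [ext0_of_notMem f (notMem_range_incl_zero w)]
  · rw [hx.2 hz, one_mul]

lemma lead_eq_zero_of_poleLE (h : PoleLE N f τ) (hNM : N < M) : lead M f τ = 0 := by
  obtain ⟨k, rfl⟩ := Nat.exists_eq_add_of_lt hNM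
  refine lead_eq ?_
  obtain ⟨C, hC⟩ := h.bound
  have h1 : Tendsto (fun z : ℂ => ((τ : ℂ), z)) (𝓝[≠] 0) (𝓝 ((τ : ℂ), 0)) :=
    ((by fun_prop : Continuous fun z : ℂ => ((τ : ℂ), z)).tendsto 0).mono_left nhdsWithin_le_nhds
  have h2 : Tendsto (fun z : ℂ => C * ‖z‖ ^ (k + 1)) (𝓝[≠] 0) (𝓝 0) := by
    have : Continuous fun z : ℂ => C * ‖z‖ ^ (k + 1) := by fun_prop
    simpa using (this.tendsto 0).mono_left nhdsWithin_le_nhds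
  refine squeeze_zero_norm' ?_ h2
  filter_upwards [h1.eventually hC] with z hz
  simp only [norm_mul, norm_pow, norm_one, mul_one] at hz ⊢
  calc ‖z‖ ^ (N + k + 1) * ‖ext0 f (τ, z)‖ = ‖z‖ ^ N * ‖ext0 f (τ, z)‖ * ‖z‖ ^ (k + 1) := by ring
    _ ≤ C * ‖z‖ ^ (k + 1) := by gcongr

/-- The order of the pole along the connected divisor `z = 0` is bounded: it is bounded near one
point, and by the identity theorem a Laurent coefficient vanishing near one point vanishes. -/
theorem IsMeromorphicLatticePoles.exists_forall_poleLE (hf : IsMeromorphicLatticePoles f) :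
    ∃ N, ∀ τ : ℍ, PoleLE N f τ := by
  obtain ⟨N, hN⟩ := hf.exists_poleLE UpperHalfPlane.I
  refine ⟨N, ?_⟩
  have hopen : IsOpen {τ : ℍ | PoleLE N f τ} :=
    isOpen_iff_mem_nhds.2 fun τ h => PoleLE.eventually h
  have hclosed : IsClosed {τ : ℍ | PoleLE N f τ} := by
    refine isClosed_of_closure_subset fun τ hτ => ?_
    obtain ⟨M, hM⟩ := hf.exists_poleLE τ
    -- The order at `τ` is at most some `M`. The coefficients of `z ^ (-j)` with `N < j ≤ M` vanish
    -- near points `σ` close to `τ`, hence near `τ` itself, and drop out one after the other.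
    have key : ∀ j, PoleLE (N + j) f τ → PoleLE N f τ := by
      intro j
      induction j with
      | zero => exact id
      | succ j ih =>
        intro h
        refine ih (h.of_lead_eq_zero hf.holo ?_)
        obtain ⟨r, hr, hd⟩ := h.exists_differentiableOn_lead hf.holo
        have hU : {w : ℍ | (w : ℂ) ∈ Metric.ball (τ : ℂ) r} ∈ 𝓝 τ :=
          UpperHalfPlane.continuous_coe.continuousAt (Metric.ball_mem_nhds _ hr)
        obtain ⟨σ, hσ1, hσ2⟩ := mem_closure_iff_nhds.1 hτ _ hU
        have hz : lead (N + (j + 1)) f =ᶠ[𝓝 (σ : ℂ)] 0 := by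
          rw [← UpperHalfPlane.isOpenEmbedding_coe.map_nhds_eq]
          refine eventually_map.2 (hσ2.eventually.mono fun w hw => ?_)
          exact lead_eq_zero_of_poleLE hw (by omega)
        have := (hd.analyticOnNhd Metric.isOpen_ball).eqOn_zero_of_preconnected_of_eventuallyEq_zero
          (convex_ball (τ : ℂ) r).isPreconnected hσ1 hz
        exact eventually_of_mem (Metric.ball_mem_nhds _ hr) this
    exact key M (hM.mono (by omega))
  have := IsClopen.eq_univ ⟨hclosed, hopen⟩ ⟨_, hN⟩
  exact fun τ => Set.eq_univ_iff_forall.1 this τ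

open scoped ModularForm

/-! ### Leading coefficients are modular forms -/

lemma lead_smul (hf : IsJacobiForm k f) (hN : PoleLE N f τ) (γ : SL(2, ℤ)) :
    lead N f ((γ • τ : ℍ) : ℂ) =
      ((γ 1 0 : ℤ) * (τ : ℂ) + (γ 1 1 : ℤ)) ^ (k - N) * lead N f τ := by
  set j : ℂ := (γ 1 0 : ℤ) * (τ : ℂ) + (γ 1 1 : ℤ) with hj
  have hj0 : j ≠ 0 := cd_ne_zero γ τ
  refine lead_eq ?_
  have h1 : Tendsto (fun z : ℂ => j * z) (𝓝[≠] 0) (𝓝[≠] 0) := by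
    refine tendsto_nhdsWithin_iff.2 ⟨?_, ?_⟩
    · have : Continuous fun z : ℂ => j * z := by fun_prop
      simpa using (this.tendsto 0).mono_left nhdsWithin_le_nhds
    · filter_upwards [self_mem_nhdsWithin] with z hz using mul_ne_zero hj0 hz
  have h2 := ((hN.tendsto_lead hf.meromorphic.holo).comp h1).const_mul (j ^ (k - N))
  refine h2.congr fun z => ?_
  have h3 := ext0_modAct hf.modular γ τ (j * z)
  rw [← hj, mul_div_cancel_left₀ _ hj0] at h3
  simp only [Function.comp_apply]
  rw [h3, zpow_sub₀ hj0, mul_pow, zpow_natCast]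
  field_simp

/-- For fixed `Im z = y` the Fourier expansion is uniformly bounded as `Im τ → ∞`, since only
non-negative powers of `q` occur. -/
lemma HasFourierExpansion.exists_bound (hf : HasFourierExpansion f) :
    ∃ y T C : ℝ, 0 < y ∧ y < T ∧ ∀ τ : ℍ, T ≤ τ.im → ∀ z : ℂ, z.im = y →
      ‖ext0 f ((τ : ℂ), z)‖ ≤ C := by
  obtain ⟨c, A, hc⟩ := hf
  set T : ℝ := max A 0 + 1 with hT
  have hT0 : 0 < T := by positivity
  have hAT : A < T := lt_of_le_of_lt (le_max_left A 0) (by linarith)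
  have hdom : ∀ (τ : ℍ) (z : ℂ), 0 < z.im → z.im < τ.im → ∀ m n : ℤ, z ≠ m * (τ : ℂ) + n := by
    rintro τ z h0 h1 m n rfl
    simp only [Complex.add_im, Complex.mul_im, Complex.intCast_re, UpperHalfPlane.coe_im,
      Complex.intCast_im, zero_mul, add_zero] at h0 h1
    have h2 : (0 : ℝ) < m := pos_of_mul_pos_left h0 τ.im_pos.le
    have h3 : (m : ℝ) < 1 := by
      by_contra h
      exact absurd h1 (not_lt.2 (le_mul_of_one_le_left τ.im_pos.le (not_lt.1 h)))
    have h4 : 0 < m := by exact_mod_cast h2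
    have h5 : m < 1 := by exact_mod_cast h3
    omega
  have hterm : ∀ (τ : ℍ) (z : ℂ) (nr : ℕ × ℤ), ‖c nr.1 nr.2 *
      Complex.exp (2 * Real.pi * Complex.I * (τ : ℂ)) ^ nr.1 *
      Complex.exp (2 * Real.pi * Complex.I * z) ^ nr.2‖ =
      ‖c nr.1 nr.2‖ * Real.exp (-(2 * Real.pi * τ.im)) ^ nr.1 *
        Real.exp (-(2 * Real.pi * z.im)) ^ nr.2 := by
    intro τ z nr
    rw [norm_mul, norm_mul, norm_pow, norm_zpow, Complex.norm_exp, Complex.norm_exp]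
    congr 4 <;> simp
  let τ₀ : ℍ := ⟨Complex.I * T, by simpa using hT0⟩
  let z₀ : ℂ := Complex.I * (T / 2 : ℝ)
  have hτ₀ : τ₀.im = T := by simp [τ₀]
  have hz₀ : z₀.im = T / 2 := by simp [z₀]
  have hs := (hc ⟨(τ₀, z₀), hdom τ₀ z₀ (by rw [hz₀]; linarith) (by rw [hz₀, hτ₀]; linarith)⟩
    (hAT.trans_eq hτ₀.symm) (show 0 < z₀.im by rw [hz₀]; linarith)
    (show z₀.im < τ₀.im by rw [hz₀, hτ₀]; linarith)).summable.norm
  refine ⟨T / 2, T, ∑' nr : ℕ × ℤ, ‖c nr.1 nr.2 *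
      Complex.exp (2 * Real.pi * Complex.I * (τ₀ : ℂ)) ^ nr.1 *
      Complex.exp (2 * Real.pi * Complex.I * z₀) ^ nr.2‖, by linarith, by linarith,
      fun τ hτ z hz => ?_⟩
  have hz0 : 0 < z.im := by rw [hz]; linarith
  have hz1 : z.im < τ.im := by rw [hz]; linarith
  let p : Dom := ⟨(τ, z), hdom τ z hz0 hz1⟩
  have hp : ext0 f ((τ : ℂ), z) = f p := ext0_incl f p
  rw [hp]
  refine (hc p (hAT.trans_le hτ) hz0 hz1).norm_le_of_bounded hs.hasSum fun nr => ?_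
  change ‖c nr.1 nr.2 * Complex.exp (2 * Real.pi * Complex.I * (τ : ℂ)) ^ nr.1 *
    Complex.exp (2 * Real.pi * Complex.I * z) ^ nr.2‖ ≤ ‖c nr.1 nr.2 *
      Complex.exp (2 * Real.pi * Complex.I * (τ₀ : ℂ)) ^ nr.1 *
      Complex.exp (2 * Real.pi * Complex.I * z₀) ^ nr.2‖
  rw [hterm, hterm, hz, hz₀, hτ₀]
  gcongr

/-- The lattice points in the strip `|Im z| < Im τ` are the integers. -/
lemma mem_range_incl_of_abs_im_lt {z : ℂ} (hz : |z.im| < τ.im) (h : ∀ n : ℤ, z ≠ n) :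
    ((τ : ℂ), z) ∈ Set.range incl := by
  refine mem_range_incl.2 ⟨τ.im_pos, fun m n hmn => ?_⟩
  simp only at hmn
  rw [hmn] at hz
  simp only [Complex.add_im, Complex.mul_im, Complex.intCast_re, UpperHalfPlane.coe_im,
    Complex.intCast_im, zero_mul, add_zero, abs_mul, abs_of_pos τ.im_pos] at hz
  have h4 : |(m : ℝ)| < 1 := by
    by_contra hc
    exact absurd hz (not_lt.2 (le_mul_of_one_le_left τ.im_pos.le (not_lt.1 hc)))
  have hm : m = 0 := Int.abs_lt_one_iff.1 (by exact_mod_cast h4)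
  exact h n (by rw [hmn, hm]; simp)

lemma tendsto_one_sub_exp_div :
    Tendsto (fun z : ℂ => (1 - Complex.exp (2 * Real.pi * Complex.I * z)) / z) (𝓝[≠] 0)
      (𝓝 (-(2 * Real.pi * Complex.I))) := by
  have h : HasDerivAt (fun z : ℂ => 1 - Complex.exp (2 * Real.pi * Complex.I * z))
      (-(Complex.exp (2 * Real.pi * Complex.I * 0) * (2 * Real.pi * Complex.I * 1))) 0 :=
    (((hasDerivAt_id (0 : ℂ)).const_mul _).cexp).const_sub 1
  have := h.tendsto_slope
  simp only [mul_zero, Complex.exp_zero, one_mul, mul_one] at this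
  refine this.congr fun z => ?_
  simp [slope_def_field]

/-- The Phragmén-Lindelöf principle for `(1 - ζ) ^ N * f (τ, ·)`, which is holomorphic in the strip
`|Im z| ≤ y` and periodic. -/
lemma norm_lead_le (hf : ∀ p : Dom, DifferentiableAt ℂ (ext0 f) (incl p))
    (hell : ∀ (m n : ℤ) (p : Dom), f (transAct m n p) = f p) (hN : PoleLE N f τ) {y C : ℝ}
    (hy : 0 < y) (hyτ : y < τ.im) (hC : ∀ z : ℂ, |z.im| = y → ‖ext0 f ((τ : ℂ), z)‖ ≤ C) :
    (2 * Real.pi) ^ N * ‖lead N f τ‖ ≤ (1 + Real.exp (2 * Real.pi * y)) ^ N * C := by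
  classical
  set Λ : AddSubgroup ℂ := (Int.castAddHom ℂ).range with hΛ
  have hmemΛ : ∀ z, z ∈ Λ ↔ ∃ n : ℤ, (n : ℂ) = z := fun z => Iff.rfl
  set G : ℂ → ℂ := fun z =>
    (1 - Complex.exp (2 * Real.pi * Complex.I * z)) ^ N * ext0 f ((τ : ℂ), z) with hG
  have hGd : ∀ z, ((τ : ℂ), z) ∈ Set.range incl → DifferentiableAt ℂ G z := by
    rintro z ⟨p, hp⟩
    have h1 : DifferentiableAt ℂ (ext0 f) ((τ : ℂ), z) := hp ▸ hf p
    have h2 : DifferentiableAt ℂ (fun z => ext0 f ((τ : ℂ), z)) z :=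
      h1.comp z ((differentiableAt_const _).prodMk differentiableAt_id)
    exact DifferentiableAt.mul (by fun_prop) h2
  have hper : ∀ l ∈ Λ, ∀ z, G (z + l) = G z := by
    rintro _ ⟨n, rfl⟩ z
    have h1 := ext0_add_lattice hell 0 n τ z
    simp only [Int.cast_zero, zero_mul, zero_add] at h1
    have h2 : Complex.exp (2 * Real.pi * Complex.I * (z + n)) =
        Complex.exp (2 * Real.pi * Complex.I * z) := by
      rw [mul_add, Complex.exp_add, mul_comm (2 * (Real.pi : ℂ) * Complex.I) n,
        Complex.exp_int_mul_two_pi_mul_I, mul_one]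
    simp only [hG, Int.coe_castAddHom, h1, h2]
  set c : ℂ := (-(2 * Real.pi * Complex.I)) ^ N * lead N f τ with hc
  have hlim : Tendsto G (𝓝[≠] 0) (𝓝 c) := by
    refine ((tendsto_one_sub_exp_div.pow N).mul (hN.tendsto_lead hf)).congr' ?_
    filter_upwards [self_mem_nhdsWithin] with z hz
    have hz : z ≠ 0 := hz
    simp only [hG]
    rw [← mul_assoc, ← mul_pow, div_mul_cancel₀ _ hz]
  have h0 : ∀ᶠ z in 𝓝[≠] (0 : ℂ), z ∉ Λ ∧ DifferentiableAt ℂ G z := by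
    have h1 : Tendsto (fun z : ℂ => ((τ : ℂ), z)) (𝓝[≠] 0) (𝓝 ((τ : ℂ), 0)) :=
      ((by fun_prop : Continuous fun z : ℂ => ((τ : ℂ), z)).tendsto 0).mono_left
        nhdsWithin_le_nhds
    filter_upwards [h1.eventually (eventually_mem_range_incl τ), self_mem_nhdsWithin] with z hz hz0
    have hr := hz.2 hz0
    refine ⟨?_, hGd z hr⟩
    rintro ⟨n, rfl⟩
    exact (mem_range_incl.1 hr).2 0 n (by simp)
  have hclosed : IsClosed (Λ : Set ℂ) := by
    have : (Λ : Set ℂ) = Set.range ((↑) : ℤ → ℂ) := rfl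
    rw [this]
    exact Complex.isClosed_range_intCast
  set F : ℂ → ℂ := fun z => if z ∈ Λ then c else G z with hF
  have hFd : ∀ z : ℂ, |z.im| < τ.im → DifferentiableAt ℂ F z := by
    intro z hz
    by_cases h : z ∈ Λ
    · exact differentiableAt_ite_mem_of_tendsto hper h0 hlim h
    · refine (hGd z (mem_range_incl_of_abs_im_lt hz
        fun n hn => h ⟨n, hn.symm⟩)).congr_of_eventuallyEq ?_
      filter_upwards [hclosed.isOpen_compl.mem_nhds h] with w hw using if_neg hw
  have hFper : ∀ (n : ℤ) z, F (z + n) = F z := by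
    intro n z
    simp only [hF]
    have hn : (n : ℂ) ∈ Λ := ⟨n, rfl⟩
    rw [Λ.add_mem_cancel_right hn, hper n hn]
  have habs : ∀ z : ℂ, -y ≤ z.im → z.im ≤ y → |z.im| < τ.im := fun z h1 h2 =>
    (abs_le.2 ⟨h1, h2⟩).trans_lt hyτ
  -- periodicity reduces boundedness in the strip to a compact rectangle
  obtain ⟨B, hB⟩ : ∃ B, ∀ z : ℂ, -y ≤ z.im → z.im ≤ y → ‖F z‖ ≤ B := by
    have hK : IsCompact (Set.Icc (0 : ℝ) 1 ×ℂ Set.Icc (-y) y) :=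
      isCompact_Icc.reProdIm isCompact_Icc
    have hcont : ContinuousOn F (Set.Icc (0 : ℝ) 1 ×ℂ Set.Icc (-y) y) := fun z hz =>
      (hFd z (habs z hz.2.1 hz.2.2)).continuousAt.continuousWithinAt
    obtain ⟨B, hB⟩ := hK.exists_bound_of_continuousOn hcont
    refine ⟨B, fun z h1 h2 => ?_⟩
    have := hFper ⌊z.re⌋ (z - ⌊z.re⌋)
    rw [sub_add_cancel] at this
    rw [this]
    refine hB _ ⟨⟨?_, ?_⟩, ⟨?_, ?_⟩⟩
    · simp
    · have := (Int.lt_floor_add_one z.re).le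
      simp only [Complex.sub_re, Complex.intCast_re]
      linarith
    · simpa using! h1
    · simpa using! h2
  have hbd : ∀ z : ℂ, |z.im| = y → ‖F z‖ ≤ (1 + Real.exp (2 * Real.pi * y)) ^ N * C := by
    intro z hz
    have hzΛ : z ∉ Λ := by
      rintro ⟨n, rfl⟩
      simp only [Int.coe_castAddHom, Complex.intCast_im, abs_zero] at hz
      exact hy.ne hz
    simp only [hF, if_neg hzΛ, hG, norm_mul, norm_pow]
    have h1 : ‖1 - Complex.exp (2 * Real.pi * Complex.I * z)‖ ≤ 1 + Real.exp (2 * Real.pi * y) := by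
      refine (norm_sub_le _ _).trans ?_
      rw [norm_one, Complex.norm_exp]
      gcongr
      have : (2 * Real.pi * Complex.I * z).re = 2 * Real.pi * (-z.im) := by simp
      rw [this, ← hz]
      gcongr
      exact neg_le_abs _
    have h2 := hC z hz
    gcongr
  have hle : ‖F 0‖ ≤ (1 + Real.exp (2 * Real.pi * y)) ^ N * C := by
    refine PhragmenLindelof.horizontal_strip (a := -y) (b := y) ?_ ⟨0, ?_, 0, ?_⟩
      (fun z hz => hbd z (by rw [hz, abs_neg, abs_of_pos hy]))
      (fun z hz => hbd z (by rw [hz, abs_of_pos hy])) (by simpa using hy.le) (by simpa using hy.le)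
    · have hcl : closure (Complex.im ⁻¹' Set.Ioo (-y) y) ⊆ Complex.im ⁻¹' Set.Icc (-y) y :=
        closure_minimal (Set.preimage_mono Set.Ioo_subset_Icc_self)
          (isClosed_Icc.preimage Complex.continuous_im)
      exact DifferentiableOn.diffContOnCl fun z hz =>
        (hFd z (habs z (hcl hz).1 (hcl hz).2)).differentiableWithinAt
    · have : 0 < y - -y := by linarith
      positivity
    · simp only [zero_mul, Real.exp_zero]
      refine Asymptotics.IsBigO.of_bound B ?_
      filter_upwards [mem_inf_of_right (mem_principal_self _)] with z hz
      simpa using hB z hz.1.le hz.2.le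
  have hF0 : F 0 = c := if_pos Λ.zero_mem
  rw [hF0, hc, norm_mul, norm_pow] at hle
  have : ‖-(2 * (Real.pi : ℂ) * Complex.I)‖ = 2 * Real.pi := by
    simp [abs_of_pos Real.pi_pos]
  rwa [this] at hle

lemma isBoundedAtImInfty_lead (hf : IsJacobiForm k f) (hN : ∀ τ, PoleLE N f τ) :
    IsBoundedAtImInfty fun τ : ℍ => lead N f τ := by
  obtain ⟨y, T, C, hy, hyT, hC⟩ := hf.fourier.exists_bound
  refine isBoundedAtImInfty_iff.2
    ⟨((2 * Real.pi) ^ N)⁻¹ * ((1 + Real.exp (2 * Real.pi * y)) ^ N * C), T, fun τ hτ => ?_⟩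
  rw [le_inv_mul_iff₀ (by positivity)]
  refine norm_lead_le hf.meromorphic.holo hf.elliptic (hN τ) hy (hyT.trans_le hτ) fun z hz => ?_
  rcases (abs_eq hy.le).1 hz with h | h
  · exact hC τ hτ z h
  · have h1 := ext0_neg hf.modular τ z
    have h2 := hC τ hτ (-z) (by simp [h])
    rwa [h1, norm_mul, norm_zpow, norm_neg, norm_one, one_zpow, one_mul] at h2

/-- The coefficient of `z ^ (-N)` in a Jacobi form of weight `k` with a pole of order at most `N`
along `z = 0`, as a modular form of weight `k - N` and level one. -/
noncomputable def leadForm (hf : IsJacobiForm k f) (hN : ∀ τ, PoleLE N f τ) :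
    ModularForm 𝒮ℒ (k - N) where
  toFun τ := lead N f τ
  slash_action_eq' A hA := by
    obtain ⟨γ, rfl⟩ := hA
    ext τ
    change ((fun τ : ℍ => lead N f τ) ∣[(k - N : ℤ)] γ) τ = _
    rw [ModularForm.SL_slash_apply, lead_smul hf (hN τ), ModularGroup.denom_apply, mul_comm,
      ← mul_assoc, ← zpow_add₀ (cd_ne_zero γ τ), neg_add_cancel, zpow_zero, one_mul]
  holo' := by
    rw [UpperHalfPlane.mdifferentiable_iff]
    intro w hw
    obtain ⟨r, hr, hd⟩ := (hN ⟨w, hw⟩).exists_differentiableOn_lead hf.meromorphic.holo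
    refine ((hd.differentiableAt (Metric.ball_mem_nhds _ hr)).congr_of_eventuallyEq
      ?_).differentiableWithinAt
    filter_upwards [isOpen_upperHalfPlaneSet.mem_nhds hw] with v hv
    simp only [Function.comp_apply, ofComplex_apply_of_im_pos hv]
    rfl
  bdd_at_cusps' {c} hc := by
    rw [OnePoint.isBoundedAt_iff_exists_SL2Z hc]
    obtain ⟨γ, rfl⟩ := isCusp_SL2Z_iff'.mp hc
    refine ⟨γ, rfl, ?_⟩
    convert isBoundedAtImInfty_lead hf hN using 1
    ext τ
    rw [ModularForm.SL_slash_apply]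
    rw [lead_smul hf (hN τ), ModularGroup.denom_apply, mul_comm,
      ← mul_assoc, ← zpow_add₀ (cd_ne_zero γ τ), neg_add_cancel, zpow_zero, one_mul]

lemma leadForm_apply (hf : IsJacobiForm k f) (hN : ∀ τ, PoleLE N f τ) (τ : ℍ) :
    leadForm hf hN τ = lead N f τ := rfl

/-! ### Elliptic functions with at most a simple pole -/

lemma exp_two_pi_I_mul_add_intCast (z : ℂ) (n : ℤ) :
    Complex.exp (2 * Real.pi * Complex.I * (z + n)) =
      Complex.exp (2 * Real.pi * Complex.I * z) := by
  rw [mul_add, Complex.exp_add, mul_comm (2 * (Real.pi : ℂ) * Complex.I) n,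
    Complex.exp_int_mul_two_pi_mul_I, mul_one]

lemma exp_two_pi_I_mul_eq_one_iff (z : ℂ) :
    Complex.exp (2 * Real.pi * Complex.I * z) = 1 ↔ ∃ n : ℤ, z = n := by
  rw [Complex.exp_eq_one_iff]
  refine exists_congr fun n => ?_
  rw [mul_comm (n : ℂ)]
  exact mul_right_inj' Complex.two_pi_I_ne_zero

lemma norm_exp_two_pi_I_mul_lt_one {z : ℂ} (hz : 0 < z.im) :
    ‖Complex.exp (2 * Real.pi * Complex.I * z)‖ < 1 := by
  rw [Complex.norm_exp, Real.exp_lt_one_iff]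
  have : (2 * Real.pi * Complex.I * z).re = -(2 * Real.pi * z.im) := by simp
  rw [this]
  have := Real.pi_pos
  nlinarith [mul_pos this hz]

/-- The function `ζ / (1 - ζ)` has the primitive `- log (1 - ζ) / (2πi)` in the upper half plane. -/
lemma integral_exp_div_one_sub_exp {a : ℝ} (ha : 0 < a) :
    ∫ x : ℝ in (-(1 / 2))..(1 / 2),
      Complex.exp (2 * Real.pi * Complex.I * (x + a * Complex.I)) /
        (1 - Complex.exp (2 * Real.pi * Complex.I * (x + a * Complex.I))) = 0 := by
  set e : ℝ → ℂ := fun x => Complex.exp (2 * Real.pi * Complex.I * (x + a * Complex.I)) with he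
  have hnorm : ∀ x, ‖e x‖ < 1 := fun x => norm_exp_two_pi_I_mul_lt_one (by simpa using ha)
  have hslit : ∀ x, 1 - e x ∈ Complex.slitPlane := fun x => by
    refine Or.inl ?_
    have := (Complex.re_le_norm (e x)).trans_lt (hnorm x)
    simp only [Complex.sub_re, Complex.one_re]
    linarith
  have hne : ∀ x, 1 - e x ≠ 0 := fun x => Complex.slitPlane_ne_zero (hslit x)
  have hder : ∀ x : ℝ, HasDerivAt e (e x * (2 * Real.pi * Complex.I)) x := by
    intro x
    have h1 : HasDerivAt (fun x : ℝ => (x : ℂ)) 1 x := Complex.ofRealCLM.hasDerivAt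
    have h2 := ((h1.add_const (a * Complex.I)).const_mul (2 * Real.pi * Complex.I)).cexp
    simpa using h2
  have hprim : ∀ x : ℝ, HasDerivAt
      (fun x => -(Complex.log (1 - e x)) / (2 * Real.pi * Complex.I)) (e x / (1 - e x)) x := by
    intro x
    have h2 := ((((hder x).const_sub 1).clog_real (hslit x)).neg).div_const
      (2 * Real.pi * Complex.I)
    have h3 := Complex.two_pi_I_ne_zero
    have h4 := hne x
    have h5 : e x / (1 - e x) =
        -(-(e x * (2 * Real.pi * Complex.I)) / (1 - e x)) / (2 * Real.pi * Complex.I) := by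
      rw [neg_div, neg_div, neg_div, neg_neg, div_right_comm, mul_div_cancel_right₀ _ h3]
    rw [h5]
    exact h2
  have hcont : Continuous fun x => e x / (1 - e x) := by
    have : Continuous e := by fun_prop
    exact this.div (continuous_const.sub this) hne
  rw [intervalIntegral.integral_eq_sub_of_hasDerivAt (fun x _ => hprim x)
    (hcont.intervalIntegrable _ _)]
  have : e (1 / 2) = e (-(1 / 2)) := by
    simp only [he]
    rw [← exp_two_pi_I_mul_add_intCast (((-(1 / 2) : ℝ) : ℂ) + a * Complex.I) 1]
    congr 2
    push_cast
    ring
  rw [this, sub_self]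

/-- There is no elliptic function with a single simple pole modulo the lattice: the residue is
computed by integrating over the boundary of the rectangle `|Re z| ≤ 1/2`, `|Im z| ≤ Im τ / 2` the
difference of the function and of a multiple of `1 / (1 - ζ)` with the same residue. -/
lemma lead_one_eq_zero (hf : ∀ p : Dom, DifferentiableAt ℂ (ext0 f) (incl p))
    (hell : ∀ (m n : ℤ) (p : Dom), f (transAct m n p) = f p) (h : PoleLE 1 f τ) :
    lead 1 f τ = 0 := by
  set l := lead 1 f τ with hl
  set φ : ℂ → ℂ := fun z => ext0 f ((τ : ℂ), z) with hφ
  set e : ℂ → ℂ := fun z => Complex.exp (2 * Real.pi * Complex.I * z) with he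
  set G : ℂ → ℂ := fun z => φ z + 2 * Real.pi * Complex.I * l * (1 / (1 - e z)) with hG
  set a : ℝ := τ.im / 2 with ha
  have ha0 : 0 < a := half_pos τ.im_pos
  have hφd : ∀ z : ℂ, |z.im| < τ.im → (∀ n : ℤ, z ≠ n) → DifferentiableAt ℂ φ z := by
    intro z h1 h2
    obtain ⟨p, hp⟩ := mem_range_incl_of_abs_im_lt h1 h2
    have h1 : DifferentiableAt ℂ (ext0 f) ((τ : ℂ), z) := hp ▸ hf p
    exact h1.comp z ((differentiableAt_const _).prodMk differentiableAt_id)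
  have hed : ∀ z : ℂ, (∀ n : ℤ, z ≠ n) → 1 - e z ≠ 0 := fun z hz h0 =>
    (exp_two_pi_I_mul_eq_one_iff z).not.2 (fun ⟨n, hn⟩ => hz n hn) (sub_eq_zero.1 h0).symm
  have hcd : ∀ z : ℂ, (∀ n : ℤ, z ≠ n) → DifferentiableAt ℂ (fun z => 1 / (1 - e z)) z := by
    intro z hz
    have : DifferentiableAt ℂ (fun z => 1 - e z) z := by fun_prop
    exact (differentiableAt_const 1).div this (hed z hz)
  have hGd : ∀ z : ℂ, |z.im| < τ.im → (∀ n : ℤ, z ≠ n) → DifferentiableAt ℂ G z :=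
    fun z h1 h2 => (hφd z h1 h2).add ((hcd z h2).const_mul _)
  set S : Set ℂ := {z | |z.re| < 1 ∧ |z.im| < τ.im} with hS
  have hSo : IsOpen S :=
    (isOpen_lt (continuous_abs.comp Complex.continuous_re) continuous_const).inter
    (isOpen_lt (continuous_abs.comp Complex.continuous_im) continuous_const)
  have hS0 : S ∈ 𝓝 (0 : ℂ) := hSo.mem_nhds ⟨by simp, by simpa using τ.im_pos⟩
  have hGS : DifferentiableOn ℂ G (S \ {0}) := by
    rintro z ⟨⟨h1, h2⟩, h0⟩
    refine (hGd z h2 ?_).differentiableWithinAt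
    rintro n rfl
    simp only [Complex.intCast_re] at h1
    have : n = 0 := Int.abs_lt_one_iff.1 (by exact_mod_cast h1)
    exact h0 (by simp [this])
  have hlittle : (fun z => G z - G 0) =o[𝓝[≠] 0] fun z => (z - 0)⁻¹ := by
    refine (Asymptotics.isLittleO_iff_tendsto' ?_).2 ?_
    · filter_upwards [self_mem_nhdsWithin] with z hz h0
      exact absurd h0 (inv_ne_zero (by simpa using hz))
    · have h1 := h.tendsto_lead hf
      have h2 := tendsto_one_sub_exp_div.inv₀ (neg_ne_zero.2 Complex.two_pi_I_ne_zero)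
      have h3 : Tendsto (fun z : ℂ => z * G 0) (𝓝[≠] 0) (𝓝 0) := by
        have : Continuous fun z : ℂ => z * G 0 := by fun_prop
        simpa using (this.tendsto 0).mono_left nhdsWithin_le_nhds
      have h4 := (h1.add (h2.const_mul (2 * Real.pi * Complex.I * l))).sub h3
      have h5 : lead 1 f τ + 2 * Real.pi * Complex.I * l * (-(2 * Real.pi * Complex.I))⁻¹ - 0 =
          0 := by
        have := Complex.two_pi_I_ne_zero
        rw [← hl]
        field_simp
        ring
      rw [h5] at h4
      refine h4.congr fun z => ?_
      simp only [hG, hφ, he, sub_zero, div_inv_eq_mul, inv_div, one_div, pow_one]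
      ring
  have hF := Complex.differentiableOn_update_limUnder_of_isLittleO hS0 hGS hlittle
  set F := Function.update G 0 (limUnder (𝓝[≠] 0) G) with hFdef
  have hFG : ∀ z ≠ 0, F z = G z := fun z hz => Function.update_of_ne hz ..
  -- the contributions of the vertical sides cancel since all functions have period `1`
  have hper : ∀ (n : ℤ) z, φ (z + n) = φ z := by
    intro n z
    have h1 := ext0_add_lattice hell 0 n τ z
    simpa only [Int.cast_zero, zero_mul, zero_add] using h1
  have hvert : ∀ y : ℝ, F ((1 / 2 : ℝ) + y * Complex.I) = F ((-(1 / 2) : ℝ) + y * Complex.I) := by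
    intro y
    have hne : ∀ s : ℝ, s ≠ 0 → ((s : ℂ) + y * Complex.I) ≠ 0 := fun s hs h0 => hs <| by
      simpa using congrArg Complex.re h0
    rw [hFG _ (hne _ (by norm_num)), hFG _ (hne _ (by norm_num))]
    have : (((1 / 2 : ℝ) : ℂ) + y * Complex.I) = ((-(1 / 2) : ℝ) + y * Complex.I) + (1 : ℤ) := by
      push_cast
      ring
    simp only [hG, he]
    rw [this, hper, exp_two_pi_I_mul_add_intCast]
  have hrect := Complex.integral_boundary_rect_eq_zero_of_differentiableOn F
    ((-(1 / 2) : ℝ) + (-a : ℝ) * Complex.I) ((1 / 2 : ℝ) + (a : ℝ) * Complex.I) (by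
      refine hF.mono ?_
      rintro z ⟨h1, h2⟩
      simp only [Complex.add_re, Complex.ofReal_re, Complex.mul_re, Complex.I_re, mul_zero,
        Complex.ofReal_im, Complex.I_im, mul_one, sub_self, add_zero, Complex.add_im,
        Complex.mul_im, zero_add, Set.mem_preimage] at h1 h2
      rw [Set.uIcc_of_le (by norm_num)] at h1
      rw [Set.uIcc_of_le (by linarith)] at h2
      refine ⟨abs_lt.2 ⟨?_, ?_⟩, abs_lt.2 ⟨?_, ?_⟩⟩
      · linarith [h1.1]
      · linarith [h1.2]
      · linarith [h2.1]
      · linarith [h2.2])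
  simp only [Complex.add_re, Complex.ofReal_re, Complex.mul_re, Complex.I_re, mul_zero,
    Complex.ofReal_im, Complex.I_im, mul_one, sub_self, add_zero, Complex.add_im,
    Complex.mul_im, zero_add, hvert, add_sub_cancel_right] at hrect
  have hint : ∀ b : ℝ, |b| = a →
      ∀ n : ℤ, ∀ x : ℝ, ((x : ℂ) + b * Complex.I) ≠ n := by
    intro b hb n x h0
    have : b = 0 := by simpa using congrArg Complex.im h0
    rw [this, abs_zero] at hb
    exact ha0.ne hb
  have him : ∀ b : ℝ, |b| = a → ∀ x : ℝ, |((x : ℂ) + b * Complex.I).im| < τ.im := by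
    intro b hb x
    simp only [Complex.add_im, Complex.ofReal_im, Complex.mul_im, Complex.ofReal_re, Complex.I_im,
      mul_one, Complex.I_re, mul_zero, add_zero, zero_add, hb, ha]
    linarith [τ.im_pos]
  have hline : ∀ b : ℝ, |b| = a → ∫ x : ℝ in (-(1 / 2))..(1 / 2), F (x + b * Complex.I) =
      (∫ x : ℝ in (-(1 / 2))..(1 / 2), φ (x + b * Complex.I)) + 2 * Real.pi * Complex.I * l *
        ∫ x : ℝ in (-(1 / 2))..(1 / 2), 1 / (1 - e (x + b * Complex.I)) := by
    intro b hb
    rw [← intervalIntegral.integral_const_mul, ← intervalIntegral.integral_add]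
    · refine intervalIntegral.integral_congr fun x _ => ?_
      exact hFG _ (by simpa using hint b hb 0 x)
    · refine Continuous.intervalIntegrable (continuous_iff_continuousAt.2 fun x => ?_) _ _
      exact ContinuousAt.comp (f := fun x : ℝ => (x : ℂ) + b * Complex.I)
        (hφd _ (him b hb x) fun n => hint b hb n x).continuousAt (by fun_prop)
    · refine Continuous.intervalIntegrable (continuous_iff_continuousAt.2 fun x => ?_) _ _
      exact continuousAt_const.mul (ContinuousAt.comp (f := fun x : ℝ => (x : ℂ) + b * Complex.I)
        (hcd _ fun n => hint b hb n x).continuousAt (by fun_prop))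
  have habs : |(-a)| = a := by rw [abs_neg, abs_of_pos ha0]
  rw [hline a (abs_of_pos ha0), hline (-a) habs] at hrect
  -- the lines `Im z = ± Im τ / 2` are equivalent under the translation by `τ`
  have hφint : ∫ x : ℝ in (-(1 / 2))..(1 / 2), φ (x + (-a : ℝ) * Complex.I) =
      ∫ x : ℝ in (-(1 / 2))..(1 / 2), φ (x + a * Complex.I) := by
    have h1 : ∀ x : ℝ, φ (x + a * Complex.I) = φ (((x - τ.re : ℝ) : ℂ) + (-a : ℝ) * Complex.I) := by
      intro x
      have h2 := ext0_add_lattice hell 1 0 τ (((x - τ.re : ℝ) : ℂ) + (-a : ℝ) * Complex.I)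
      simp only [hφ]
      rw [← h2]
      congr 2
      refine Complex.ext ?_ ?_ <;> simp [ha]
      ring
    simp only [h1]
    rw [intervalIntegral.integral_comp_sub_right
      (fun x : ℝ => φ ((x : ℂ) + (-a : ℝ) * Complex.I)) τ.re]
    have hp : Function.Periodic (fun x : ℝ => φ ((x : ℂ) + (-a : ℝ) * Complex.I)) 1 := by
      intro x
      have h2 := hper 1 ((x : ℂ) + (-a : ℝ) * Complex.I)
      simp only
      rw [← h2]
      congr 1
      push_cast
      ring
    have h3 := hp.intervalIntegral_add_eq (-(1 / 2)) (-(1 / 2) - τ.re)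
    have h4 : (-(1 / 2) : ℝ) + 1 = 1 / 2 := by norm_num
    have h5 : (-(1 / 2) : ℝ) - τ.re + 1 = 1 / 2 - τ.re := by ring
    rw [h4, h5] at h3
    exact h3
  have hup : ∫ x : ℝ in (-(1 / 2))..(1 / 2), 1 / (1 - e (x + a * Complex.I)) = 1 := by
    have h1 : ∀ x : ℝ, 1 / (1 - e (x + a * Complex.I)) =
        1 + e (x + a * Complex.I) / (1 - e (x + a * Complex.I)) := by
      intro x
      have := hed _ fun n => hint a (abs_of_pos ha0) n x
      field_simp
      ring
    simp only [h1]
    rw [intervalIntegral.integral_add (by simp), integral_exp_div_one_sub_exp ha0]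
    · simp
      norm_num
    · refine Continuous.intervalIntegrable (Continuous.div (by fun_prop) (by fun_prop)
        fun x => hed _ fun n => hint a (abs_of_pos ha0) n x) _ _
  have hdown : ∫ x : ℝ in (-(1 / 2))..(1 / 2), 1 / (1 - e (x + (-a : ℝ) * Complex.I)) = 0 := by
    have h1 : ∀ x : ℝ, 1 / (1 - e (x + (-a : ℝ) * Complex.I)) =
        -(e (((-x : ℝ) : ℂ) + a * Complex.I) / (1 - e (((-x : ℝ) : ℂ) + a * Complex.I))) := by
      intro x
      have h2 : e (((-x : ℝ) : ℂ) + a * Complex.I) = (e (x + (-a : ℝ) * Complex.I))⁻¹ := by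
        simp only [he]
        rw [← Complex.exp_neg]
        congr 1
        push_cast
        ring
      have h3 := hed _ fun n => hint (-a) habs n x
      have h4 : e (x + (-a : ℝ) * Complex.I) ≠ 0 := Complex.exp_ne_zero _
      have h5 : e (x + (-a : ℝ) * Complex.I) - 1 ≠ 0 := fun h => h3 (by
        rw [sub_eq_zero.1 h, sub_self])
      rw [h2]
      field_simp
      ring
    simp only [h1]
    rw [intervalIntegral.integral_neg, intervalIntegral.integral_comp_neg
      (fun x : ℝ => e ((x : ℂ) + a * Complex.I) / (1 - e ((x : ℂ) + a * Complex.I))), neg_neg,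
      integral_exp_div_one_sub_exp ha0, neg_zero]
  rw [hφint, hup, hdown] at hrect
  have h6 : 2 * Real.pi * Complex.I * l = 0 := by linear_combination -hrect
  exact (mul_eq_zero.1 h6).resolve_left Complex.two_pi_I_ne_zero

/-- Liouville's theorem: an elliptic function without poles is constant. -/
lemma PoleLE.eq_lead_zero (hf : ∀ p : Dom, DifferentiableAt ℂ (ext0 f) (incl p))
    (hell : ∀ (m n : ℤ) (p : Dom), f (transAct m n p) = f p) (h : PoleLE 0 f τ) {z : ℂ}
    (hz : ((τ : ℂ), z) ∈ Set.range incl) : ext0 f ((τ : ℂ), z) = lead 0 f τ := by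
  classical
  set Λ : AddSubgroup ℂ := AddSubgroup.closure {(τ : ℂ), 1} with hΛ
  have hmem : ∀ z, z ∈ Λ ↔ ∃ m n : ℤ, m * (τ : ℂ) + n = z := fun z => by
    simp [hΛ, AddSubgroup.mem_closure_pair]
  set G : ℂ → ℂ := fun z => ext0 f ((τ : ℂ), z) with hG
  have hΛ' : ∀ z, z ∉ Λ ↔ ((τ : ℂ), z) ∈ Set.range incl := by
    intro z
    rw [mem_range_incl, hmem]
    simp only [not_exists]
    exact ⟨fun h => ⟨τ.im_pos, fun m n hmn => h m n hmn.symm⟩, fun h m n hmn => h.2 m n hmn.symm⟩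
  have hGd : ∀ z, z ∉ Λ → DifferentiableAt ℂ G z := by
    intro z hz
    obtain ⟨p, hp⟩ := (hΛ' z).1 hz
    have h1 : DifferentiableAt ℂ (ext0 f) ((τ : ℂ), z) := hp ▸ hf p
    exact h1.comp z ((differentiableAt_const _).prodMk differentiableAt_id)
  have hper : ∀ l ∈ Λ, ∀ z, G (z + l) = G z := by
    intro l hl z
    obtain ⟨m, n, rfl⟩ := (hmem l).1 hl
    exact ext0_add_lattice hell m n τ z
  have hlim : Tendsto G (𝓝[≠] 0) (𝓝 (lead 0 f τ)) := by
    simpa using h.tendsto_lead hf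
  have h0 : ∀ᶠ z in 𝓝[≠] (0 : ℂ), z ∉ Λ ∧ DifferentiableAt ℂ G z := by
    have h1 : Tendsto (fun z : ℂ => ((τ : ℂ), z)) (𝓝[≠] 0) (𝓝 ((τ : ℂ), 0)) :=
      ((by fun_prop : Continuous fun z : ℂ => ((τ : ℂ), z)).tendsto 0).mono_left
        nhdsWithin_le_nhds
    filter_upwards [h1.eventually (eventually_mem_range_incl τ), self_mem_nhdsWithin] with z hz hz0
    have hr := (hΛ' z).2 (hz.2 hz0)
    exact ⟨hr, hGd z hr⟩
  set F : ℂ → ℂ := fun z => if z ∈ Λ then lead 0 f τ else G z with hF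
  have hopen : IsOpen {z | z ∉ Λ} := by
    simp only [hΛ']
    exact isOpen_range_incl.preimage (by fun_prop : Continuous fun z : ℂ => ((τ : ℂ), z))
  have hFd : Differentiable ℂ F := by
    intro z
    by_cases hz : z ∈ Λ
    · exact differentiableAt_ite_mem_of_tendsto hper h0 hlim hz
    · refine (hGd z hz).congr_of_eventuallyEq ?_
      filter_upwards [hopen.mem_nhds hz] with w hw using if_neg hw
  have hFper : ∀ l ∈ Λ, ∀ z, F (z + l) = F z := by
    intro l hl z
    simp only [hF]
    rw [Λ.add_mem_cancel_right hl, hper l hl]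
  have hbdd : Bornology.IsBounded (Set.range F) := by
    have hK : IsCompact ((fun s : ℝ × ℝ => (s.1 : ℂ) * τ + s.2) ''
        (Set.Icc (0 : ℝ) 1 ×ˢ Set.Icc (0 : ℝ) 1)) :=
      (isCompact_Icc.prod isCompact_Icc).image (by fun_prop)
    refine (hK.image hFd.continuous).isBounded.subset ?_
    rintro _ ⟨z, rfl⟩
    set s : ℝ := z.im / τ.im with hs
    set t : ℝ := z.re - s * τ.re with ht
    have hz : z = (s : ℂ) * τ + t := by
      refine Complex.ext ?_ ?_
      · simp [ht]
      · simp [hs, τ.im_ne_zero]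
    refine ⟨Int.fract s * τ + Int.fract t, ⟨(Int.fract s, Int.fract t), ⟨⟨Int.fract_nonneg _,
      (Int.fract_lt_one _).le⟩, ⟨Int.fract_nonneg _, (Int.fract_lt_one _).le⟩⟩, rfl⟩, ?_⟩
    rw [← hFper (⌊s⌋ * (τ : ℂ) + ⌊t⌋) ((hmem _).2 ⟨_, _, rfl⟩)]
    congr 1
    rw [hz, Int.fract, Int.fract]
    push_cast
    ring
  have h1 := hFd.apply_eq_apply_of_bounded hbdd z 0
  simpa only [hF, if_pos Λ.zero_mem, if_neg ((hΛ' z).2 hz)] using h1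

/-! ### The graded algebra of Jacobi forms -/

/-- An expansion in monomials `q ^ n ζ ^ r` over an arbitrary index set: terms with the same
exponents are collected. -/
lemma HasFourierExpansion.of_hasSum {ι : Type*} (s : ι → ℕ × ℤ) (c : ι → ℂ) (A : ℝ)
    (h : ∀ p : Dom, A < p.1.1.im → 0 < p.1.2.im → p.1.2.im < p.1.1.im →
      HasSum (fun i => c i * Complex.exp (2 * Real.pi * Complex.I * (p.1.1 : ℂ)) ^ (s i).1 *
        Complex.exp (2 * Real.pi * Complex.I * p.1.2) ^ (s i).2) (f p)) :
    HasFourierExpansion f := by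
  refine ⟨fun n r => ∑' i : {i // s i = (n, r)}, c i, A, fun p h1 h2 h3 => ?_⟩
  have hσ := (Equiv.sigmaFiberEquiv s).hasSum_iff.2 (h p h1 h2 h3)
  refine (hσ.sigma fun i => (hσ.summable.sigma_factor i).hasSum).congr_fun fun nr => ?_
  rw [mul_assoc, ← tsum_mul_right]
  refine tsum_congr ?_
  rintro ⟨i, hi⟩
  obtain rfl : s i = nr := hi
  simp only [Function.comp_apply, Equiv.sigmaFiberEquiv_apply, mul_assoc]

lemma hasSum_prod_mul {ι κ : Type*} {F : ι → ℂ} {G : κ → ℂ} {a b : ℂ} (hF : HasSum F a)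
    (hG : HasSum G b) : HasSum (fun x : ι × κ => F x.1 * G x.2) (a * b) :=
  hF.mul hG (summable_mul_of_summable_norm hF.summable.norm hG.summable.norm)

lemma HasFourierExpansion.mul (hf : HasFourierExpansion f) (hg : HasFourierExpansion g) :
    HasFourierExpansion (f * g) := by
  obtain ⟨c, A, hc⟩ := hf
  obtain ⟨d, B, hd⟩ := hg
  refine HasFourierExpansion.of_hasSum (fun x : (ℕ × ℤ) × (ℕ × ℤ) => x.1 + x.2)
    (fun x => c x.1.1 x.1.2 * d x.2.1 x.2.2) (max A B) fun p h1 h2 h3 => ?_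
  have hζ0 : Complex.exp (2 * Real.pi * Complex.I * p.1.2) ≠ 0 := Complex.exp_ne_zero _
  have hF := hc p ((le_max_left _ _).trans_lt h1) h2 h3
  have hG := hd p ((le_max_right _ _).trans_lt h1) h2 h3
  have hFG := hasSum_prod_mul hF hG
  clear hF hG
  generalize Complex.exp (2 * Real.pi * Complex.I * (p.1.1 : ℂ)) = q at hFG ⊢
  generalize Complex.exp (2 * Real.pi * Complex.I * p.1.2) = ζ at hFG hζ0 ⊢
  refine hFG.congr_fun fun x => ?_
  simp only [Prod.fst_add, Prod.snd_add, pow_add, zpow_add₀ hζ0]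
  ring

lemma HasFourierExpansion.add (hf : HasFourierExpansion f) (hg : HasFourierExpansion g) :
    HasFourierExpansion (f + g) := by
  obtain ⟨c, A, hc⟩ := hf
  obtain ⟨d, B, hd⟩ := hg
  refine ⟨c + d, max A B, fun p h1 h2 h3 => ?_⟩
  have := (hc p ((le_max_left _ _).trans_lt h1) h2 h3).add
    (hd p ((le_max_right _ _).trans_lt h1) h2 h3)
  simpa only [Pi.add_apply, add_mul] using this

lemma HasFourierExpansion.congr (hf : HasFourierExpansion f)
    (h : ∀ p : Dom, 0 < p.1.2.im → p.1.2.im < p.1.1.im → f p = g p) : HasFourierExpansion g := by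
  obtain ⟨c, A, hc⟩ := hf
  exact ⟨c, A, fun p h1 h2 h3 => h p h2 h3 ▸ hc p h1 h2 h3⟩

/-- The Fourier expansion of a function of `τ` alone. -/
lemma hasFourierExpansion_of_hasSum_pow {F : ℍ → ℂ} {c : ℕ → ℂ}
    (h : ∀ τ : ℍ, HasSum (fun n => c n * Complex.exp (2 * Real.pi * Complex.I * (τ : ℂ)) ^ n)
      (F τ)) :
    HasFourierExpansion fun p => F p.1.1 :=
  HasFourierExpansion.of_hasSum (fun n => (n, 0)) c 0 fun p _ _ _ => by simpa using h p.1.1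

/-- For an elliptic function only the poles on the component `z = 0` have to be considered. -/
lemma isMeromorphicLatticePoles_of_elliptic
    (hf : ∀ p : Dom, DifferentiableAt ℂ (ext0 f) (incl p))
    (hell : ∀ (m n : ℤ) (p : Dom), f (transAct m n p) = f p)
    (h : ∀ τ : ℍ, ∃ (N : ℕ) (g : ℂ × ℂ → ℂ), ∀ᶠ x in 𝓝 (((τ : ℂ), 0) : ℂ × ℂ),
      DifferentiableAt ℂ g x ∧ (x.2 ≠ 0 → x.2 ^ N * ext0 f x = g x)) :
    IsMeromorphicLatticePoles f := by
  refine ⟨hf, fun τ m n => ?_⟩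
  obtain ⟨N, g, hg⟩ := h τ
  let s : ℂ × ℂ → ℂ × ℂ := fun x => (x.1, x.2 - m * x.1 - n)
  have hs : Differentiable ℂ s := by fun_prop
  have hs0 : Tendsto s (𝓝 ((τ : ℂ), m * (τ : ℂ) + n)) (𝓝 ((τ : ℂ), 0)) := by
    have := hs.continuous.tendsto ((τ : ℂ), m * (τ : ℂ) + n)
    simpa only [s, add_sub_cancel_left, sub_self] using this
  refine ⟨N, g ∘ s, ?_⟩
  filter_upwards [hs0.eventually hg] with x hx
  refine ⟨hx.1.comp x (hs x), fun h0 => ?_⟩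
  have h1 := hx.2 (by
    simp only [s]
    rwa [sub_sub, sub_ne_zero])
  rw [Function.comp_apply, ← h1]
  have h2 := ext0_add_lattice hell m n x.1 (x.2 - m * x.1 - n)
  rw [show x.2 - m * x.1 - n + (m * x.1 + n) = x.2 by ring] at h2
  simp only [s, ← h2]

lemma IsMeromorphicLatticePoles.mul (hf : IsMeromorphicLatticePoles f)
    (hg : IsMeromorphicLatticePoles g) : IsMeromorphicLatticePoles (f * g) := by
  refine ⟨fun p => ?_, fun τ m n => ?_⟩
  · rw [ext0_mul]
    exact (hf.holo p).mul (hg.holo p)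
  · obtain ⟨N, F, hF⟩ := hf.mero τ m n
    obtain ⟨M, G, hG⟩ := hg.mero τ m n
    refine ⟨N + M, F * G, ?_⟩
    filter_upwards [hF, hG] with x hx hy
    refine ⟨hx.1.mul hy.1, fun h => ?_⟩
    rw [ext0_mul, Pi.mul_apply, Pi.mul_apply, ← hx.2 h, ← hy.2 h]
    ring

lemma IsJacobiForm.mul (hf : IsJacobiForm k f) (hg : IsJacobiForm l g) :
    IsJacobiForm (k + l) (f * g) where
  meromorphic := hf.meromorphic.mul hg.meromorphic
  fourier := hf.fourier.mul hg.fourier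
  modular γ p := by
    simp only [Pi.mul_apply, hf.modular, hg.modular, zpow_add₀ (cd_ne_zero γ p.1.1)]
    ring
  elliptic m n p := by simp only [Pi.mul_apply, hf.elliptic, hg.elliptic]

lemma isJacobiForm_one : IsJacobiForm 0 1 where
  meromorphic := by
    have h1 : ∀ x ∈ Set.range incl, ext0 1 x = 1 := by
      rintro _ ⟨p, rfl⟩
      exact ext0_incl 1 p
    refine isMeromorphicLatticePoles_of_elliptic (fun p => ?_) (fun _ _ _ => rfl)
      fun τ => ⟨0, fun _ => 1, ?_⟩
    · refine (differentiableAt_const (1 : ℂ)).congr_of_eventuallyEq ?_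
      filter_upwards [isOpen_range_incl.mem_nhds ⟨p, rfl⟩] with x hx using h1 x hx
    · filter_upwards [eventually_mem_range_incl τ] with x hx
      exact ⟨differentiableAt_const _, fun h0 => by rw [h1 x (hx.2 h0), pow_zero, one_mul]⟩
  fourier := hasFourierExpansion_of_hasSum_pow (F := 1) (c := fun n => if n = 0 then 1 else 0)
    fun τ => by
      refine (hasSum_ite_eq 0 (1 : ℂ)).congr_fun fun n => ?_
      by_cases hn : n = 0 <;> simp [hn]
  modular γ p := by simp
  elliptic m n p := rfl

lemma IsJacobiForm.pow (hf : IsJacobiForm k f) (n : ℕ) : IsJacobiForm (n * k) (f ^ n) := by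
  induction n with
  | zero => simpa using isJacobiForm_one
  | succ n ih =>
    have := ih.mul hf
    rw [pow_succ]
    convert this using 1
    push_cast
    ring

/-! ### Sums over the lattice -/

lemma summable_one_add_norm_pow_inv :
    Summable fun ω : ℤ × ℤ => ((1 + ‖ω‖) ^ 3)⁻¹ := by
  have h1 := EisensteinSeries.summable_one_div_norm_rpow (k := 3) (by norm_num)
  have h2 := (finTwoArrowEquiv ℤ).symm.summable_iff.2 h1
  refine Summable.of_norm_bounded_eventually h2 ?_
  have : {(0 : ℤ × ℤ)}ᶜ ∈ (cofinite : Filter (ℤ × ℤ)) := (Set.finite_singleton _).compl_mem_cofinite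
  filter_upwards [this] with ω hω
  have hω : ω ≠ 0 := hω
  have hn : ‖(finTwoArrowEquiv ℤ).symm ω‖ = ‖ω‖ := by
    simp [Pi.norm_def, Prod.norm_def, Fin.univ_succ]
  have hpos : 0 < ‖ω‖ := norm_pos_iff.2 hω
  rw [Function.comp_apply, hn, norm_inv, norm_pow, Real.norm_of_nonneg (by positivity),
    show ((3 : ℝ)) = ((3 : ℕ) : ℝ) by norm_num, Real.rpow_neg hpos.le, Real.rpow_natCast]
  gcongr
  linarith

lemma mul_add_intCast_ne_zero {w : ℂ} (h : 0 < w.im) {ω : ℤ × ℤ} (hω : ω ≠ 0) :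
    ω.1 * w + ω.2 ≠ 0 := by
  intro h0
  have h1 : (ω.1 : ℝ) * w.im = 0 := by simpa using congrArg Complex.im h0
  have h2 : ω.1 = 0 := by simpa [h.ne'] using h1
  have h3 : ω.2 = 0 := by simpa [h2] using h0
  exact hω (Prod.ext h2 h3)

/-- A uniform lower bound for `|z + aτ + b|`. -/
lemma exists_le_norm_add_lattice (x₀ : ℂ × ℂ) (h0 : 0 < x₀.1.im) :
    ∃ δ > 0, ∀ᶠ x : ℂ × ℂ in 𝓝 x₀, ∀ ω : ℤ × ℤ, x₀.2 + ω.1 * x₀.1 + ω.2 ≠ 0 →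
      δ * (1 + ‖ω‖) ≤ ‖x.2 + ω.1 * x.1 + ω.2‖ := by
  obtain ⟨c, hc, hcb⟩ : ∃ c > 0, ∀ ω : ℤ × ℤ, c * ‖ω‖ ≤ ‖ω.1 * x₀.1 + ω.2‖ := by
    refine ⟨EisensteinSeries.r ⟨x₀.1, h0⟩, EisensteinSeries.r_pos _, fun ω => ?_⟩
    by_cases hω : ω = 0
    · simp [hω]
    have hne : ![ω.1, ω.2] ≠ 0 := fun h => hω (Prod.ext (congrFun h 0) (congrFun h 1))
    have hn : ‖![ω.1, ω.2]‖ = ‖ω‖ := by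
      simp [Pi.norm_def, Prod.norm_def, Fin.univ_succ]
    have := EisensteinSeries.r_mul_max_le ⟨x₀.1, h0⟩ hne
    rw [hn] at this
    simpa using this
  obtain ⟨δ, hδ, hδb⟩ : ∃ δ > 0, ∀ ω : ℤ × ℤ, x₀.2 + ω.1 * x₀.1 + ω.2 ≠ 0 →
      δ * (1 + ‖ω‖) ≤ ‖x₀.2 + ω.1 * x₀.1 + ω.2‖ := by
    set R : ℝ := 1 + 2 * ‖x₀.2‖ / c with hR
    have hfin : (Metric.closedBall (0 : ℤ × ℤ) R).Finite :=
      (isCompact_closedBall _ _).finite_of_discrete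
    obtain ⟨ρ, hρ, hρb⟩ : ∃ ρ > 0, ∀ ω ∈ Metric.closedBall (0 : ℤ × ℤ) R,
        x₀.2 + ω.1 * x₀.1 + ω.2 ≠ 0 → ρ ≤ ‖x₀.2 + ω.1 * x₀.1 + ω.2‖ := by
      have := (Set.Finite.eventually_all (l := 𝓝[>] (0 : ℝ)) hfin (p := fun ω ρ =>
        x₀.2 + ω.1 * x₀.1 + ω.2 ≠ 0 → ρ ≤ ‖x₀.2 + ω.1 * x₀.1 + ω.2‖)).2 fun ω _ => by
          by_cases h : x₀.2 + ω.1 * x₀.1 + ω.2 ≠ 0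
          · exact (eventually_nhdsWithin_of_eventually_nhds
              (eventually_le_nhds (norm_pos_iff.2 h))).mono fun _ h _ => h
          · exact Eventually.of_forall fun _ h' => absurd h' h
      obtain ⟨ρ, h1, h2⟩ := (this.and self_mem_nhdsWithin).exists
      exact ⟨ρ, h2, h1⟩
    have hR1 : 1 ≤ R := by rw [hR]; linarith [show 0 ≤ 2 * ‖x₀.2‖ / c by positivity]
    refine ⟨min (c / 4) (ρ / (1 + R)), by positivity, fun ω hω => ?_⟩
    by_cases hωR : ‖ω‖ ≤ R
    · have h1 := hρb ω (by simpa using hωR) hω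
      refine le_trans ?_ h1
      calc min (c / 4) (ρ / (1 + R)) * (1 + ‖ω‖) ≤ ρ / (1 + R) * (1 + R) := by
            gcongr
            exact min_le_right _ _
        _ = ρ := by field_simp
    · push Not at hωR
      have h1 : ‖x₀.2‖ ≤ c / 2 * ‖ω‖ := by
        have : 2 * ‖x₀.2‖ / c ≤ ‖ω‖ := by linarith
        rw [div_le_iff₀ hc] at this
        linarith
      have h2 : ‖ω.1 * x₀.1 + ω.2‖ ≤ ‖x₀.2 + ω.1 * x₀.1 + ω.2‖ + ‖x₀.2‖ := by
        refine le_trans (le_of_eq ?_) (norm_sub_le _ _)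
        congr 1
        ring
      calc min (c / 4) (ρ / (1 + R)) * (1 + ‖ω‖) ≤ c / 4 * (‖ω‖ + ‖ω‖) := by
            gcongr
            · exact min_le_left _ _
            · linarith
        _ = c * ‖ω‖ - c / 2 * ‖ω‖ := by ring
        _ ≤ _ := by linarith [hcb ω]
  refine ⟨δ / 2, half_pos hδ, ?_⟩
  filter_upwards [Metric.ball_mem_nhds x₀ (half_pos hδ)] with x hx ω hω
  rw [← ball_prod_same, Set.mem_prod, mem_ball_iff_norm, mem_ball_iff_norm] at hx
  have h1 : ‖x₀.2 + ω.1 * x₀.1 + ω.2‖ ≤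
      ‖x.2 + ω.1 * x.1 + ω.2‖ + (‖x.2 - x₀.2‖ + ‖ω.1 * (x.1 - x₀.1)‖) := by
    have h := (norm_sub_le (x.2 + ω.1 * x.1 + ω.2) ((x.2 - x₀.2) + ω.1 * (x.1 - x₀.1)))
    rw [show x.2 + ω.1 * x.1 + ω.2 - ((x.2 - x₀.2) + ω.1 * (x.1 - x₀.1)) =
      x₀.2 + ω.1 * x₀.1 + ω.2 by ring] at h
    exact h.trans (by gcongr; exact norm_add_le _ _)
  have h2 : ‖ω.1 * (x.1 - x₀.1)‖ ≤ ‖ω‖ * (δ / 2) := by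
    rw [norm_mul]
    gcongr
    · rw [Complex.norm_intCast, ← Int.norm_eq_abs]
      exact norm_fst_le ω
    · exact hx.1.le
  linarith [hδb ω hω, hx.2]

/-- The summands `t ω`, `ω ∈ ℤ × ℤ`, of a sum over the lattice: away from the pole at `z = -ω` they
are holomorphic and dominated by `‖ω‖ ^ (-3)`, locally uniformly. -/
def IsLatticeSummand (t : ℤ × ℤ → ℂ × ℂ → ℂ) : Prop :=
  ∀ x₀ : ℂ × ℂ, 0 < x₀.1.im → ∃ C : ℝ, ∀ᶠ x in 𝓝 x₀, ∀ ω : ℤ × ℤ, x₀.2 + ω.1 * x₀.1 + ω.2 ≠ 0 →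
    DifferentiableAt ℂ (t ω) x ∧ ‖t ω x‖ ≤ C * ((1 + ‖ω‖) ^ 3)⁻¹

lemma differentiableAt_one_div_pow {u : ℂ × ℂ → ℂ} {x : ℂ × ℂ} {n : ℕ}
    (hu : DifferentiableAt ℂ u x) (h : u x ≠ 0) :
    DifferentiableAt ℂ (fun x => 1 / u x ^ n) x := by
  have h1 : DifferentiableAt ℂ (fun x => u x ^ n) x := hu.pow n
  have h2 : DifferentiableAt ℂ (fun x => (u x ^ n)⁻¹) x := h1.inv (pow_ne_zero n h)
  simpa only [one_div] using h2

lemma isLatticeSummand_inv_pow {n : ℕ} (hn : 3 ≤ n) :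
    IsLatticeSummand fun ω x => 1 / (x.2 + ω.1 * x.1 + ω.2) ^ n := by
  intro x₀ h0
  obtain ⟨δ, hδ, h⟩ := exists_le_norm_add_lattice x₀ h0
  refine ⟨(δ ^ n)⁻¹, h.mono fun x hx ω hω => ?_⟩
  have h1 := hx ω hω
  have h2 : 0 < δ * (1 + ‖ω‖) := by positivity
  have h3 : x.2 + ω.1 * x.1 + ω.2 ≠ 0 := norm_pos_iff.1 (h2.trans_le h1)
  refine ⟨differentiableAt_one_div_pow (by fun_prop) h3, ?_⟩
  rw [norm_div, norm_one, norm_pow, one_div, ← mul_inv]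
  refine inv_anti₀ (by positivity) ?_
  calc δ ^ n * (1 + ‖ω‖) ^ 3 ≤ δ ^ n * (1 + ‖ω‖) ^ n := by
        gcongr
        linarith [norm_nonneg ω]
    _ = (δ * (1 + ‖ω‖)) ^ n := (mul_pow _ _ _).symm
    _ ≤ _ := by gcongr

lemma isLatticeSummand_inv_sq_sub :
    IsLatticeSummand fun ω x => 1 / (x.2 + ω.1 * x.1 + ω.2) ^ 2 - 1 / (ω.1 * x.1 + ω.2) ^ 2 := by
  intro x₀ h0
  obtain ⟨δ, hδ, h⟩ := exists_le_norm_add_lattice x₀ h0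
  obtain ⟨ε, hε, h'⟩ := exists_le_norm_add_lattice (x₀.1, 0) h0
  have hb : ∀ᶠ x in 𝓝 x₀, ‖x.2‖ < ‖x₀.2‖ + 1 :=
    (isOpen_lt (continuous_norm.comp continuous_snd) continuous_const).mem_nhds (by simp)
  have h'' : ∀ᶠ x : ℂ × ℂ in 𝓝 x₀, ∀ ω : ℤ × ℤ, ω ≠ 0 → ε * (1 + ‖ω‖) ≤ ‖ω.1 * x.1 + ω.2‖ := by
    have ht : Tendsto (fun x : ℂ × ℂ => (x.1, (0 : ℂ))) (𝓝 x₀) (𝓝 (x₀.1, 0)) :=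
      (by fun_prop : Continuous fun x : ℂ × ℂ => (x.1, (0 : ℂ))).tendsto x₀
    filter_upwards [ht.eventually h'] with x hx ω hω
    simpa using hx ω (by simpa using mul_add_intCast_ne_zero h0 hω)
  set K := ‖x₀.2‖ + 1 with hK
  have hK0 : 0 < K := by positivity
  refine ⟨(δ ^ 2)⁻¹ + K * ((δ ^ 2 * ε)⁻¹ + (δ * ε ^ 2)⁻¹), ?_⟩
  filter_upwards [h, h'', hb] with x h1 h2 h3 ω hω
  have h1 := h1 ω hω
  have h4 : 0 < δ * (1 + ‖ω‖) := by positivity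
  have h5 : x.2 + ω.1 * x.1 + ω.2 ≠ 0 := norm_pos_iff.1 (h4.trans_le h1)
  by_cases hω0 : ω = 0
  · subst hω0
    simp only [Prod.fst_zero, Prod.snd_zero, Int.cast_zero, zero_mul, add_zero, ne_eq,
      OfNat.ofNat_ne_zero, not_false_eq_true, zero_pow, div_zero, sub_zero, norm_zero, one_pow,
      inv_one, mul_one] at h1 h5 ⊢
    refine ⟨differentiableAt_one_div_pow (by fun_prop) h5, ?_⟩
    rw [norm_div, norm_one, norm_pow, one_div]
    have : (‖x.2‖ ^ 2)⁻¹ ≤ (δ ^ 2)⁻¹ := inv_anti₀ (by positivity) (by gcongr)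
    refine this.trans (le_add_of_nonneg_right (by positivity))
  have h2 := h2 ω hω0
  have h6 : 0 < ε * (1 + ‖ω‖) := by positivity
  have h7 : ω.1 * x.1 + ω.2 ≠ 0 := norm_pos_iff.1 (h6.trans_le h2)
  refine ⟨(differentiableAt_one_div_pow (by fun_prop) h5).sub
    (differentiableAt_one_div_pow (by fun_prop) h7), ?_⟩
  have h8 : 1 / (x.2 + ω.1 * x.1 + ω.2) ^ 2 - 1 / (ω.1 * x.1 + ω.2) ^ 2 =
      -x.2 * (1 / ((x.2 + ω.1 * x.1 + ω.2) ^ 2 * (ω.1 * x.1 + ω.2)) +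
        1 / ((x.2 + ω.1 * x.1 + ω.2) * (ω.1 * x.1 + ω.2) ^ 2)) := by
    field_simp
    ring
  rw [h8, norm_mul, norm_neg]
  have h9 : ‖1 / ((x.2 + ω.1 * x.1 + ω.2) ^ 2 * (ω.1 * x.1 + ω.2))‖ ≤
      (δ ^ 2 * ε)⁻¹ * ((1 + ‖ω‖) ^ 3)⁻¹ := by
    rw [norm_div, norm_one, norm_mul, norm_pow, one_div, ← mul_inv]
    refine inv_anti₀ (by positivity) ?_
    calc δ ^ 2 * ε * (1 + ‖ω‖) ^ 3 = (δ * (1 + ‖ω‖)) ^ 2 * (ε * (1 + ‖ω‖)) := by ring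
      _ ≤ _ := by gcongr
  have h10 : ‖1 / ((x.2 + ω.1 * x.1 + ω.2) * (ω.1 * x.1 + ω.2) ^ 2)‖ ≤
      (δ * ε ^ 2)⁻¹ * ((1 + ‖ω‖) ^ 3)⁻¹ := by
    rw [norm_div, norm_one, norm_mul, norm_pow, one_div, ← mul_inv]
    refine inv_anti₀ (by positivity) ?_
    calc δ * ε ^ 2 * (1 + ‖ω‖) ^ 3 = (δ * (1 + ‖ω‖)) * (ε * (1 + ‖ω‖)) ^ 2 := by ring
      _ ≤ _ := by gcongr
  calc _ ≤ K * ((δ ^ 2 * ε)⁻¹ * ((1 + ‖ω‖) ^ 3)⁻¹ + (δ * ε ^ 2)⁻¹ * ((1 + ‖ω‖) ^ 3)⁻¹) := by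
        gcongr
        exact (norm_add_le _ _).trans (by gcongr)
    _ ≤ _ := by
        have : 0 ≤ (δ ^ 2)⁻¹ * ((1 + ‖ω‖) ^ 3)⁻¹ := by positivity
        linarith

section

variable {t : ℤ × ℤ → ℂ × ℂ → ℂ}

lemma IsLatticeSummand.summable (ht : IsLatticeSummand t) (p : Dom) :
    Summable fun ω => t ω (incl p) := by
  obtain ⟨C, hC⟩ := ht (incl p) p.1.1.im_pos
  refine Summable.of_norm_bounded (summable_one_add_norm_pow_inv.mul_left C) fun ω => ?_
  refine (hC.self_of_nhds ω fun h => p.2 (-ω.1) (-ω.2) ?_).2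
  simp only [incl] at h
  push_cast
  linear_combination h

lemma IsLatticeSummand.differentiableAt (ht : IsLatticeSummand t)
    (hf : ∀ p, f p = ∑' ω, t ω (incl p)) (p : Dom) : DifferentiableAt ℂ (ext0 f) (incl p) := by
  refine DifferentiableAt.congr_of_eventuallyEq ?_
    (ext0_eventuallyEq (F := fun x => ∑' ω, t ω x) hf p)
  obtain ⟨C, hC⟩ := ht (incl p) p.1.1.im_pos
  refine differentiableAt_tsum_of_eventually (summable_one_add_norm_pow_inv.mul_left C)
    (hC.mono fun x hx ω => hx ω fun h => p.2 (-ω.1) (-ω.2) ?_)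
  simp only [incl] at h
  push_cast
  linear_combination h

/-- Only the summand `ω = 0` contributes to the polar part at `z = 0`. -/
lemma IsLatticeSummand.exists_differentiableAt_pole (ht : IsLatticeSummand t)
    (hf : ∀ p, f p = ∑' ω, t ω (incl p)) {n : ℕ}
    (h0 : ∀ x : ℂ × ℂ, x.2 ≠ 0 → t 0 x = 1 / x.2 ^ n) (τ : ℍ) :
    ∃ G : ℂ × ℂ → ℂ, ∀ᶠ x in 𝓝 (((τ : ℂ), 0) : ℂ × ℂ), DifferentiableAt ℂ G x ∧
      (x.2 ≠ 0 → x.2 ^ n * ext0 f x = 1 + x.2 ^ n * G x) := by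
  obtain ⟨C, hC⟩ := ht ((τ : ℂ), 0) τ.im_pos
  have hne : ∀ ω : ℤ × ℤ, ω ≠ 0 → (0 : ℂ) + ω.1 * (τ : ℂ) + ω.2 ≠ 0 := by
    intro ω hω
    simpa using mul_add_intCast_ne_zero τ.im_pos hω
  refine ⟨fun x => ∑' ω, if ω = 0 then 0 else t ω x, ?_⟩
  have hC' : ∀ᶠ x in 𝓝 (((τ : ℂ), 0) : ℂ × ℂ), ∀ ω, DifferentiableAt ℂ
      (fun x => if ω = 0 then 0 else t ω x) x ∧
      ‖if ω = 0 then 0 else t ω x‖ ≤ |C| * ((1 + ‖ω‖) ^ 3)⁻¹ := by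
    filter_upwards [hC] with x hx ω
    by_cases hω : ω = 0
    · simp only [hω, if_true, norm_zero]
      exact ⟨differentiableAt_const _, by positivity⟩
    · simp only [hω, if_false]
      refine ⟨(hx ω (hne ω hω)).1, (hx ω (hne ω hω)).2.trans ?_⟩
      gcongr
      exact le_abs_self C
  filter_upwards [hC'.eventually_nhds, eventually_mem_range_incl τ] with x hx hr
  refine ⟨differentiableAt_tsum_of_eventually (summable_one_add_norm_pow_inv.mul_left |C|) hx,
    fun hx0 => ?_⟩
  obtain ⟨p, rfl⟩ := hr.2 hx0
  rw [ext0_incl, hf, (ht.summable p).tsum_eq_add_tsum_ite 0, h0 _ hx0, mul_add, mul_one_div,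
    div_self (pow_ne_zero _ hx0)]

lemma IsLatticeSummand.isMeromorphicLatticePoles (ht : IsLatticeSummand t)
    (hf : ∀ p, f p = ∑' ω, t ω (incl p)) {n : ℕ}
    (h0 : ∀ x : ℂ × ℂ, x.2 ≠ 0 → t 0 x = 1 / x.2 ^ n)
    (hell : ∀ (m n : ℤ) (p : Dom), f (transAct m n p) = f p) : IsMeromorphicLatticePoles f := by
  refine isMeromorphicLatticePoles_of_elliptic (ht.differentiableAt hf) hell fun τ => ?_
  obtain ⟨G, hG⟩ := ht.exists_differentiableAt_pole hf h0 τ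
  refine ⟨n, fun x => 1 + x.2 ^ n * G x, hG.mono fun x hx => ⟨?_, hx.2⟩⟩
  exact (differentiableAt_const _).add (DifferentiableAt.mul (by fun_prop) hx.1)

lemma IsLatticeSummand.poleLE (ht : IsLatticeSummand t)
    (hf : ∀ p, f p = ∑' ω, t ω (incl p)) {n : ℕ} (hn : n ≠ 0)
    (h0 : ∀ x : ℂ × ℂ, x.2 ≠ 0 → t 0 x = 1 / x.2 ^ n) (τ : ℍ) : PoleLE n f τ := by
  obtain ⟨G, hG⟩ := ht.exists_differentiableAt_pole hf h0 τ
  have hc : ContinuousAt (fun x : ℂ × ℂ => 1 + x.2 ^ n * G x) ((τ : ℂ), 0) :=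
    continuousAt_const.add (ContinuousAt.mul (by fun_prop) hG.self_of_nhds.1.continuousAt)
  refine Asymptotics.IsBigO.trans (Asymptotics.IsBigO.of_bound 1 ?_) (hc.isBigO_one ℝ)
  filter_upwards [hG] with x hx
  by_cases h : x.2 = 0
  · simp [h, hn]
  · rw [hx.2 h, one_mul]

lemma IsLatticeSummand.lead_eq_one (ht : IsLatticeSummand t)
    (hf : ∀ p, f p = ∑' ω, t ω (incl p)) {n : ℕ} (hn : n ≠ 0)
    (h0 : ∀ x : ℂ × ℂ, x.2 ≠ 0 → t 0 x = 1 / x.2 ^ n) (τ : ℍ) : lead n f τ = 1 := by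
  obtain ⟨G, hG⟩ := ht.exists_differentiableAt_pole hf h0 τ
  refine lead_eq ?_
  have hc : ContinuousAt (fun x : ℂ × ℂ => 1 + x.2 ^ n * G x) ((τ : ℂ), 0) :=
    continuousAt_const.add (ContinuousAt.mul (by fun_prop) hG.self_of_nhds.1.continuousAt)
  have h1 : Tendsto (fun z : ℂ => ((τ : ℂ), z)) (𝓝[≠] 0) (𝓝 ((τ : ℂ), 0)) :=
    ((by fun_prop : Continuous fun z : ℂ => ((τ : ℂ), z)).tendsto 0).mono_left nhdsWithin_le_nhds
  have h2 := hc.tendsto.comp h1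
  simp only [ne_eq, hn, not_false_eq_true, zero_pow, zero_mul, add_zero] at h2
  refine h2.congr' ?_
  filter_upwards [h1.eventually hG, self_mem_nhdsWithin] with z hz hz0
  exact (hz.2 hz0).symm

end

/-! ### The Weierstrass function and the Eisenstein functions -/

/-- The Weierstrass function of the lattice `ℤτ + ℤ`. The summand of `ω = 0` is `1 / z ^ 2`, since
`1 / 0 = 0`. -/
noncomputable def wp (p : Dom) : ℂ :=
  ∑' ω : ℤ × ℤ, (1 / (p.1.2 + ω.1 * (p.1.1 : ℂ) + ω.2) ^ 2 - 1 / (ω.1 * (p.1.1 : ℂ) + ω.2) ^ 2)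

/-- The right action of `SL₂(ℤ)` on row vectors. -/
def rowEquiv (γ : SL(2, ℤ)) : ℤ × ℤ ≃ ℤ × ℤ where
  toFun ω := (ω.1 * γ 0 0 + ω.2 * γ 1 0, ω.1 * γ 0 1 + ω.2 * γ 1 1)
  invFun ω := (ω.1 * γ 1 1 - ω.2 * γ 1 0, -ω.1 * γ 0 1 + ω.2 * γ 0 0)
  left_inv ω := by
    have h := γ.det_coe
    rw [Matrix.det_fin_two] at h
    refine Prod.ext ?_ ?_
    · simp only
      linear_combination ω.1 * h
    · simp only
      linear_combination ω.2 * h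
  right_inv ω := by
    have h := γ.det_coe
    rw [Matrix.det_fin_two] at h
    refine Prod.ext ?_ ?_
    · simp only
      linear_combination ω.1 * h
    · simp only
      linear_combination ω.2 * h

lemma mul_smul_add_eq_div (γ : SL(2, ℤ)) (τ : ℍ) (ω : ℤ × ℤ) :
    ω.1 * ((γ • τ : ℍ) : ℂ) + ω.2 =
      ((rowEquiv γ ω).1 * (τ : ℂ) + (rowEquiv γ ω).2) /
        ((γ 1 0 : ℤ) * (τ : ℂ) + (γ 1 1 : ℤ)) := by
  have hd := cd_ne_zero γ τ
  simp only [UpperHalfPlane.coe_specialLinearGroup_apply, algebraMap_int_eq, eq_intCast,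
    Complex.ofReal_intCast, rowEquiv, Equiv.coe_fn_mk]
  rw [eq_div_iff hd, add_mul, mul_assoc, div_mul_cancel₀ _ hd]
  push_cast
  ring

lemma E_modAct (n : ℕ) (γ : SL(2, ℤ)) (p : Dom) :
    E n (modAct γ p) = ((γ 1 0 : ℤ) * (p.1.1 : ℂ) + (γ 1 1 : ℤ)) ^ (n : ℤ) * E n p := by
  simp only [E, modAct]
  rw [zpow_natCast, ← tsum_mul_left]
  refine Eq.trans (tsum_congr fun ω => ?_) ((rowEquiv γ).tsum_eq _)
  rw [add_assoc, mul_smul_add_eq_div, ← add_div, div_pow, one_div_div, add_assoc, mul_one_div]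

lemma wp_modAct (γ : SL(2, ℤ)) (p : Dom) :
    wp (modAct γ p) = ((γ 1 0 : ℤ) * (p.1.1 : ℂ) + (γ 1 1 : ℤ)) ^ (2 : ℤ) * wp p := by
  simp only [wp, modAct]
  rw [zpow_ofNat, ← tsum_mul_left]
  refine Eq.trans (tsum_congr fun ω => ?_) ((rowEquiv γ).tsum_eq _)
  rw [add_assoc, mul_smul_add_eq_div, ← add_div, div_pow, one_div_div, add_assoc, mul_sub,
    mul_one_div, mul_one_div, div_pow, one_div_div]

lemma E_transAct (n : ℕ) (a b : ℤ) (p : Dom) : E n (transAct a b p) = E n p := by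
  simp only [E, transAct]
  rw [← (Equiv.addRight ((a, b) : ℤ × ℤ)).tsum_eq
    fun ω : ℤ × ℤ => 1 / (p.1.2 + ω.1 * (p.1.1 : ℂ) + ω.2) ^ n]
  refine tsum_congr fun ω => ?_
  simp only [Equiv.coe_addRight, Prod.fst_add, Prod.snd_add]
  push_cast
  congr 2
  ring

/-- The periods `τ`, `1` of the lattice `ℤτ + ℤ`. -/
noncomputable def periodPair (τ : ℍ) : PeriodPair where
  ω₁ := τ
  ω₂ := 1
  indep := by
    refine LinearIndependent.pair_iff.2 fun s t h => ?_
    have h1 : s * τ.im = 0 := by simpa using congrArg Complex.im h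
    have h2 : s = 0 := (mul_eq_zero.1 h1).resolve_right τ.im_ne_zero
    refine ⟨h2, ?_⟩
    simpa [h2] using h

lemma tsum_lattice (τ : ℍ) (F : ℂ → ℂ) :
    ∑' l : (periodPair τ).lattice, F l = ∑' ω : ℤ × ℤ, F (ω.1 * (τ : ℂ) + ω.2) := by
  rw [← (periodPair τ).latticeEquivProd.symm.toEquiv.tsum_eq]
  refine tsum_congr fun ω => ?_
  congr 1
  refine ((periodPair τ).latticeEquiv_symm_apply ω).trans ?_
  simp [periodPair]

lemma tsum_lattice_neg (τ : ℍ) (F : ℂ → ℂ) :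
    ∑' l : (periodPair τ).lattice, F (-l) = ∑' ω : ℤ × ℤ, F (ω.1 * (τ : ℂ) + ω.2) := by
  rw [← tsum_lattice, ← (Equiv.neg (periodPair τ).lattice).tsum_eq]
  simp

lemma notMem_lattice (p : Dom) : p.1.2 ∉ (periodPair p.1.1).lattice := by
  rw [PeriodPair.mem_lattice]
  rintro ⟨m, n, h⟩
  exact p.2 m n (by simpa [periodPair] using h.symm)

lemma wp_eq_weierstrassP (p : Dom) : wp p = (periodPair p.1.1).weierstrassP p.1.2 := by
  rw [PeriodPair.weierstrassP, wp]
  have := tsum_lattice_neg p.1.1 fun w => 1 / (p.1.2 + w) ^ 2 - 1 / w ^ 2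
  simp only [← add_assoc] at this
  rw [← this]
  refine tsum_congr fun l => ?_
  rw [← sub_eq_add_neg, neg_sq]

lemma E_three_eq_derivWeierstrassP (p : Dom) :
    -2 * E 3 p = (periodPair p.1.1).derivWeierstrassP p.1.2 := by
  rw [PeriodPair.derivWeierstrassP, E]
  have := tsum_lattice_neg p.1.1 fun w => 1 / (p.1.2 + w) ^ 3
  simp only [← add_assoc] at this
  rw [← this, neg_mul, neg_inj, ← tsum_mul_left]
  refine tsum_congr fun l => ?_
  rw [← sub_eq_add_neg, mul_one_div]

lemma wp_transAct (a b : ℤ) (p : Dom) : wp (transAct a b p) = wp p := by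
  rw [wp_eq_weierstrassP, wp_eq_weierstrassP]
  have h : (a * (p.1.1 : ℂ) + b) ∈ (periodPair p.1.1).lattice := by
    rw [PeriodPair.mem_lattice]
    exact ⟨a, b, by simp [periodPair]⟩
  have := (periodPair p.1.1).weierstrassP_add_coe p.1.2 ⟨_, h⟩
  simp only [transAct, add_assoc]
  exact this

lemma isMeromorphicLatticePoles_E {n : ℕ} (hn : 3 ≤ n) : IsMeromorphicLatticePoles (E n) :=
  (isLatticeSummand_inv_pow hn).isMeromorphicLatticePoles (fun _ => rfl) (n := n) (by simp)
    (E_transAct n)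

lemma poleLE_E {n : ℕ} (hn : 3 ≤ n) (τ : ℍ) : PoleLE n (E n) τ :=
  (isLatticeSummand_inv_pow hn).poleLE (fun _ => rfl) (by omega) (by simp) τ

lemma lead_E {n : ℕ} (hn : 3 ≤ n) (τ : ℍ) : lead n (E n) τ = 1 :=
  (isLatticeSummand_inv_pow hn).lead_eq_one (fun _ => rfl) (by omega) (by simp) τ

lemma isMeromorphicLatticePoles_wp : IsMeromorphicLatticePoles wp :=
  isLatticeSummand_inv_sq_sub.isMeromorphicLatticePoles (fun _ => rfl) (n := 2) (by simp)
    wp_transAct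

lemma poleLE_wp (τ : ℍ) : PoleLE 2 wp τ :=
  isLatticeSummand_inv_sq_sub.poleLE (fun _ => rfl) (by omega) (by simp) τ

lemma lead_wp (τ : ℍ) : lead 2 wp τ = 1 :=
  isLatticeSummand_inv_sq_sub.lead_eq_one (fun _ => rfl) (by omega) (by simp) τ

lemma summable_one_div_add_intCast_sq (w : ℂ) : Summable fun b : ℤ => 1 / (w + b) ^ 2 := by
  have h := EisensteinSeries.linear_right_summable w 1 (k := 2) le_rfl
  refine h.congr fun b => ?_
  simp [zpow_ofNat]

lemma tsum_symmetricIcc_eq {F : ℤ → ℂ} (hF : Summable F) :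
    ∑'[SummationFilter.symmetricIcc ℤ] b, F b = ∑' b, F b :=
  tsum_eq_of_summable_unconditional hF

lemma hasSum_E2 (p : Dom) :
    HasSum (fun a : ℤ => ∑' b : ℤ, 1 / (p.1.2 + a * (p.1.1 : ℂ) + b) ^ 2)
      (EisensteinSeries.G2 p.1.1 + wp p) (SummationFilter.symmetricIcc ℤ) := by
  have h1 : HasSum (EisensteinSeries.e2Summand · p.1.1) (EisensteinSeries.G2 p.1.1)
      (SummationFilter.symmetricIcc ℤ) :=
    (EisensteinSeries.summable_e2Summand_symmetricIcc p.1.1).hasSum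
  have h2 := isLatticeSummand_inv_sq_sub.summable p
  have h3 : HasSum (fun a : ℤ => ∑' b : ℤ, (1 / (p.1.2 + a * (p.1.1 : ℂ) + b) ^ 2 -
      1 / (a * (p.1.1 : ℂ) + b) ^ 2)) (wp p) :=
    h2.hasSum.prod_fiberwise fun a => (h2.prod_factor a).hasSum
  have h4 := h1.add (h3.mono_left (SummationFilter.symmetricIcc ℤ).le_atTop)
  refine h4.congr_fun fun a => ?_
  rw [Summable.tsum_sub (summable_one_div_add_intCast_sq _) (summable_one_div_add_intCast_sq _)]
  rw [EisensteinSeries.e2Summand]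
  simp [EisensteinSeries.eisSummand, zpow_ofNat]

lemma E2_eq_tsum (p : Dom) : E2 p = ∑'[SummationFilter.symmetricIcc ℤ] a : ℤ,
    ∑' b : ℤ, 1 / (p.1.2 + a * (p.1.1 : ℂ) + b) ^ 2 := by
  rw [E2]
  congr 1
  ext a
  exact tsum_symmetricIcc_eq (summable_one_div_add_intCast_sq _)

/-- The Eisenstein summations of `E_2` and of `e_2` differ by the absolutely convergent series
of the Weierstrass function. -/
lemma E2_sub_e2 : E2 - e2 = wp := by
  ext p
  rw [Pi.sub_apply, E2_eq_tsum, (hasSum_E2 p).tsum_eq, e2, add_sub_cancel_left]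

/-! ### Fourier expansions of the Eisenstein functions -/

lemma summable_pow_mul_geometric_prod {q x : ℂ} (hq : ‖q‖ < 1) (hx : ‖x‖ < 1) (k : ℕ) :
    Summable fun i : ℕ × ℕ => ((i.2 + 1 : ℕ) : ℂ) ^ k * (q ^ i.1 * x) ^ (i.2 + 1) := by
  have h1 : Summable fun m : ℕ => ‖((m : ℂ) ^ k * x ^ m : ℂ)‖ :=
    summable_norm_pow_mul_geometric_of_norm_lt_one k hx
  have h2 := (summable_nat_add_iff 1).2 h1
  have h3 := (summable_geometric_of_lt_one (norm_nonneg q) hq).mul_of_nonneg h2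
    (fun _ => by positivity) (fun _ => by positivity)
  refine Summable.of_norm_bounded h3 fun i => ?_
  have h4 : ‖q‖ ^ (i.1 * (i.2 + 1)) ≤ ‖q‖ ^ i.1 :=
    pow_le_pow_of_le_one (norm_nonneg q) hq.le (Nat.le_mul_of_pos_right _ (Nat.succ_pos _))
  rw [norm_mul, norm_pow, mul_pow, norm_mul, norm_mul, norm_pow, norm_pow, norm_pow, norm_pow,
    ← pow_mul]
  calc _ = ‖q‖ ^ (i.1 * (i.2 + 1)) * (‖((i.2 + 1 : ℕ) : ℂ)‖ ^ k * ‖x‖ ^ (i.2 + 1)) := by ring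
    _ ≤ _ := by gcongr

/-- The Lipschitz formula. -/
lemma tsum_one_div_add_intCast_pow {n : ℕ} (hn : 1 ≤ n) {w : ℂ} (hw : 0 < w.im) :
    ∑' b : ℤ, 1 / (w + b) ^ (n + 1) = (-2 * Real.pi * Complex.I) ^ (n + 1) / n.factorial *
      ∑' m : ℕ, ((m + 1 : ℕ) : ℂ) ^ n * Complex.exp (2 * Real.pi * Complex.I * w) ^ (m + 1) := by
  have := EisensteinSeries.qExpansion_identity_pnat hn ⟨w, hw⟩
  rw [tsum_pnat_eq_tsum_succ (f := fun m : ℕ =>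
    (m : ℂ) ^ n * Complex.exp (2 * Real.pi * Complex.I * w) ^ m)] at this
  exact this

lemma tsum_one_div_neg_add_intCast_pow (n : ℕ) (w : ℂ) :
    ∑' b : ℤ, 1 / (-w + b) ^ n = (-1) ^ n * ∑' b : ℤ, 1 / (w + b) ^ n := by
  rw [← (Equiv.neg ℤ).tsum_eq, ← tsum_mul_left]
  refine tsum_congr fun b => ?_
  have h1 : -w + ((-b : ℤ) : ℂ) = -(w + b) := by push_cast; ring
  rw [Equiv.neg_apply, h1, neg_pow (w + b), one_div, mul_inv, ← inv_pow, inv_neg, inv_one, one_div]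

/-- The Fourier expansion of the iterated series: the terms with `a ≥ 0` are expanded in powers
of `q ^ a ζ`, those with `a < 0` in powers of `q ^ |a| / ζ`. -/
lemma hasFourierExpansion_of_hasSum_tsum {n : ℕ} (hn : 1 ≤ n) (L : SummationFilter ℤ) [L.LeAtTop]
    [L.NeBot]
    (hf : ∀ p : Dom, HasSum (fun a : ℤ => ∑' b : ℤ, 1 / (p.1.2 + a * (p.1.1 : ℂ) + b) ^ (n + 1))
      (f p) L) : HasFourierExpansion f := by
  set K : ℂ := (-2 * Real.pi * Complex.I) ^ (n + 1) / n.factorial with hK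
  set q : Dom → ℂ := fun p => Complex.exp (2 * Real.pi * Complex.I * (p.1.1 : ℂ)) with hq
  set ζ : Dom → ℂ := fun p => Complex.exp (2 * Real.pi * Complex.I * p.1.2) with hζ
  set ξ : Dom → ℂ := fun p => q p * (ζ p)⁻¹ with hξ
  have hq1 : ∀ p, ‖q p‖ < 1 := fun p => norm_exp_two_pi_I_mul_lt_one p.1.1.im_pos
  have hζ1 : ∀ p : Dom, 0 < p.1.2.im → ‖ζ p‖ < 1 := fun p hp => norm_exp_two_pi_I_mul_lt_one hp
  have hξ' : ∀ p, ξ p = Complex.exp (2 * Real.pi * Complex.I * ((p.1.1 : ℂ) - p.1.2)) := by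
    intro p
    simp only [hξ, hq, hζ]
    rw [← Complex.exp_neg, ← Complex.exp_add]
    ring_nf
  have hξ1 : ∀ p : Dom, p.1.2.im < p.1.1.im → ‖ξ p‖ < 1 := fun p hp => by
    rw [hξ']
    exact norm_exp_two_pi_I_mul_lt_one (by simpa using hp)
  set S : ℂ → ℂ → ℂ := fun q x =>
    ∑' i : ℕ × ℕ, ((i.2 + 1 : ℕ) : ℂ) ^ n * (q ^ i.1 * x) ^ (i.2 + 1) with hS
  have hS' : ∀ {q x : ℂ}, ‖q‖ < 1 → ‖x‖ < 1 → HasSum (fun i : ℕ × ℕ =>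
      ((i.2 + 1 : ℕ) : ℂ) ^ n * (q ^ i.1 * x) ^ (i.2 + 1)) (S q x) := fun hq hx =>
    (summable_pow_mul_geometric_prod hq hx n).hasSum
  have hpos : HasFourierExpansion fun p => K * S (q p) (ζ p) := by
    refine HasFourierExpansion.of_hasSum (fun i : ℕ × ℕ => (i.1 * (i.2 + 1), ((i.2 + 1 : ℕ) : ℤ)))
      (fun i => K * ((i.2 + 1 : ℕ) : ℂ) ^ n) 0 fun p _ h1 _ => ?_
    refine ((hS' (hq1 p) (hζ1 p h1)).mul_left K).congr_fun fun i => ?_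
    simp only [zpow_natCast, mul_pow, ← pow_mul, hq, hζ, mul_assoc]
  have hneg : HasFourierExpansion fun p => (-1) ^ (n + 1) * K * S (q p) (ξ p) := by
    refine HasFourierExpansion.of_hasSum
      (fun i : ℕ × ℕ => ((i.1 + 1) * (i.2 + 1), -((i.2 + 1 : ℕ) : ℤ)))
      (fun i => (-1) ^ (n + 1) * K * ((i.2 + 1 : ℕ) : ℂ) ^ n) 0 fun p _ h1 h2 => ?_
    refine ((hS' (hq1 p) (hξ1 p h2)).mul_left ((-1) ^ (n + 1) * K)).congr_fun fun i => ?_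
    change (-1) ^ (n + 1) * K * ((i.2 + 1 : ℕ) : ℂ) ^ n * q p ^ ((i.1 + 1) * (i.2 + 1)) *
      ζ p ^ (-((i.2 + 1 : ℕ) : ℤ)) = _
    simp only [hξ]
    generalize q p = x
    generalize ζ p = y
    rw [zpow_neg, zpow_natCast, ← inv_pow]
    ring
  refine (hpos.add hneg).congr fun p h1 h2 => ?_
  set B : ℤ → ℂ := fun a => ∑' b : ℤ, 1 / (p.1.2 + a * (p.1.1 : ℂ) + b) ^ (n + 1) with hB
  have hB1 : HasSum (fun a : ℕ => B a) (K * S (q p) (ζ p)) := by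
    have h3 := (hS' (hq1 p) (hζ1 p h1))
    refine ((h3.prod_fiberwise fun a => (h3.summable.prod_factor a).hasSum).mul_left K).congr_fun
      fun a => ?_
    have h4 : 0 < (p.1.2 + ((a : ℤ) : ℂ) * (p.1.1 : ℂ)).im := by
      have := p.1.1.im_pos
      simp
      positivity
    simp only [hB]
    rw [tsum_one_div_add_intCast_pow hn h4]
    congr 1
    refine tsum_congr fun m => ?_
    congr 2
    simp only [hq, hζ]
    rw [← Complex.exp_nat_mul, ← Complex.exp_add]
    congr 1
    push_cast
    ring
  have hB2 : HasSum (fun a : ℕ => B (-(a + 1))) ((-1) ^ (n + 1) * K * S (q p) (ξ p)) := by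
    have h3 := (hS' (hq1 p) (hξ1 p h2))
    refine ((h3.prod_fiberwise fun a => (h3.summable.prod_factor a).hasSum).mul_left
      ((-1) ^ (n + 1) * K)).congr_fun fun a => ?_
    have h4 : 0 < (((p.1.1 : ℂ) - p.1.2) + a * (p.1.1 : ℂ)).im := by
      have := p.1.1.im_pos
      have := sub_pos.2 h2
      simp
      positivity
    have h5 : ∀ b : ℤ, p.1.2 + ((-(a + 1) : ℤ) : ℂ) * (p.1.1 : ℂ) + b =
        -(((p.1.1 : ℂ) - p.1.2) + a * (p.1.1 : ℂ)) + b := by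
      intro b
      push_cast
      ring
    simp only [hB, h5]
    rw [tsum_one_div_neg_add_intCast_pow, tsum_one_div_add_intCast_pow hn h4, ← mul_assoc]
    congr 1
    refine tsum_congr fun m => ?_
    congr 2
    simp only [hξ']
    simp only [hq]
    rw [← Complex.exp_nat_mul, ← Complex.exp_add]
    congr 1
    ring
  have h6 := hB1.of_nat_of_neg_add_one hB2
  have h7 : HasSum B _ L := h6.mono_left L.le_atTop
  exact h7.unique (hf p)

lemma isJacobiForm_E {n : ℕ} (hn : 3 ≤ n) : IsJacobiForm n (E n) where
  meromorphic := isMeromorphicLatticePoles_E hn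
  fourier := by
    obtain ⟨m, rfl⟩ := Nat.exists_eq_add_of_le' (show 1 ≤ n by omega)
    refine hasFourierExpansion_of_hasSum_tsum (n := m) (by omega) (SummationFilter.unconditional ℤ)
      fun p => ?_
    have h := (isLatticeSummand_inv_pow hn).summable p
    exact h.hasSum.prod_fiberwise fun a => (h.prod_factor a).hasSum
  modular := E_modAct n
  elliptic := E_transAct n

lemma hasFourierExpansion_e2 : HasFourierExpansion e2 := by
  refine hasFourierExpansion_of_hasSum_pow (F := EisensteinSeries.G2) (c := fun n =>
    2 * riemannZeta 2 * (if n = 0 then 1 else -24 * ArithmeticFunction.sigma 1 n : ℂ)) fun τ => ?_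
  have h := (EisensteinSeries.hasSum_qExpansion_E2 τ).mul_left (2 * riemannZeta 2)
  have h2 : 2 * riemannZeta 2 ≠ 0 :=
    mul_ne_zero two_ne_zero (riemannZeta_ne_zero_of_one_lt_re (by norm_num))
  have h3 : 2 * riemannZeta 2 * EisensteinSeries.E2 τ = EisensteinSeries.G2 τ := by
    rw [EisensteinSeries.E2, Pi.smul_apply, smul_eq_mul, ← mul_assoc, mul_one_div_cancel h2,
      one_mul]
  rw [h3] at h
  refine h.congr_fun fun n => ?_
  simp [mul_assoc]

lemma isJacobiForm_wp : IsJacobiForm 2 wp where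
  meromorphic := isMeromorphicLatticePoles_wp
  fourier := by
    have h1 : HasFourierExpansion E2 := by
      refine hasFourierExpansion_of_hasSum_tsum le_rfl (SummationFilter.symmetricIcc ℤ) fun p => ?_
      rw [E2_eq_tsum]
      exact (hasSum_E2 p).summable.hasSum
    have h2 : HasFourierExpansion ((-1 : ℂ) • e2) := by
      obtain ⟨c, A, hc⟩ := hasFourierExpansion_e2
      exact ⟨(-1 : ℂ) • c, A, fun p h1 h2 h3 => by
        simpa only [Pi.smul_apply, smul_eq_mul, mul_assoc] using (hc p h1 h2 h3).mul_left (-1)⟩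
    have h3 := h1.add h2
    rwa [neg_one_smul, ← sub_eq_add_neg, E2_sub_e2] at h3
  modular := wp_modAct
  elliptic := wp_transAct

/-! ### Modular forms as polynomials in the generators -/

/-- The space of weighted homogeneous polynomials of weight `k` in `℘`, `E_3`, `E_4`. -/
def monomialSpan (k : ℤ) : Submodule ℂ (Dom → ℂ) :=
  Submodule.span ℂ {f | ∃ i j l : ℕ, (2 * i + 3 * j + 4 * l : ℤ) = k ∧
    f = wp ^ i * E 3 ^ j * E 4 ^ l}

lemma wp_pow_mul_E_pow_mem_monomialSpan (i j l : ℕ) :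
    wp ^ i * E 3 ^ j * E 4 ^ l ∈ monomialSpan (2 * i + 3 * j + 4 * l) :=
  Submodule.subset_span ⟨i, j, l, rfl, rfl⟩

lemma monomialSpan_le_jacobiForms (k : ℤ) : monomialSpan k ≤ jacobiForms k := by
  refine Submodule.span_le.2 ?_
  rintro _ ⟨i, j, l, rfl, rfl⟩
  have h := ((isJacobiForm_wp.pow i).mul ((isJacobiForm_E le_rfl).pow j)).mul
    ((isJacobiForm_E (n := 4) (by norm_num)).pow l)
  change IsJacobiForm _ _
  convert h using 1
  push_cast
  ring

lemma mul_mem_monomialSpan (hf : f ∈ monomialSpan k) (hg : g ∈ monomialSpan l) :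
    f * g ∈ monomialSpan (k + l) := by
  refine Submodule.span_induction₂ (p := fun x y _ _ => x * y ∈ monomialSpan (k + l))
    ?_ ?_ ?_ ?_ ?_ ?_ ?_ hf hg
  · rintro _ _ ⟨a, b, c, rfl, rfl⟩ ⟨a', b', c', rfl, rfl⟩
    refine Submodule.subset_span ⟨a + a', b + b', c + c', ?_, ?_⟩
    · push_cast
      ring
    · ring
  · intro y _
    rw [zero_mul]
    exact Submodule.zero_mem _
  · intro x _
    rw [mul_zero]
    exact Submodule.zero_mem _
  · intro x y z _ _ _ h1 h2
    rw [add_mul]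
    exact Submodule.add_mem _ h1 h2
  · intro x y z _ _ _ h1 h2
    rw [mul_add]
    exact Submodule.add_mem _ h1 h2
  · intro c x y _ _ h
    rw [smul_mul_assoc]
    exact Submodule.smul_mem _ c h
  · intro c x y _ _ h
    rw [mul_smul_comm]
    exact Submodule.smul_mem _ c h

lemma one_mem_monomialSpan : (1 : Dom → ℂ) ∈ monomialSpan 0 := by
  simpa using wp_pow_mul_E_pow_mem_monomialSpan 0 0 0

lemma pow_mem_monomialSpan (hf : f ∈ monomialSpan k) (n : ℕ) : f ^ n ∈ monomialSpan (n * k) := by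
  induction n with
  | zero => simpa using one_mem_monomialSpan
  | succ n ih =>
    have := mul_mem_monomialSpan ih hf
    rwa [pow_succ, show ((n + 1 : ℕ) : ℤ) * k = n * k + k by push_cast; ring]

lemma wp_mem_monomialSpan : wp ∈ monomialSpan 2 := by
  simpa using wp_pow_mul_E_pow_mem_monomialSpan 1 0 0

lemma E_three_mem_monomialSpan : E 3 ∈ monomialSpan 3 := by
  simpa using wp_pow_mul_E_pow_mem_monomialSpan 0 1 0

lemma E_four_mem_monomialSpan : E 4 ∈ monomialSpan 4 := by
  simpa using wp_pow_mul_E_pow_mem_monomialSpan 0 0 1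

lemma E_four_eq_sumInvPow (p : Dom) : E 4 p = (periodPair p.1.1).sumInvPow p.1.2 4 := by
  rw [PeriodPair.sumInvPow, E]
  have := tsum_lattice_neg p.1.1 fun w => 1 / (p.1.2 + w) ^ 4
  simp only [← add_assoc] at this
  rw [← this]
  refine tsum_congr fun l => ?_
  rw [one_div, ← sub_eq_add_neg, ← neg_sub (l : ℂ), Even.neg_pow (by decide)]

/-- The differential equation `6 ℘² - ℘'' = g₂ / 2`, from that of first order by
differentiation; the factor `℘'` is cancelled by means of the identity theorem. -/
lemma wp_sq_sub_E_four (p : Dom) : 12 * (wp p ^ 2 - E 4 p) = (periodPair p.1.1).g₂ := by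
  set τ := p.1.1 with hτ
  set L := periodPair τ with hL
  have hopen : IsOpen ((L.lattice : Set ℂ)ᶜ) := L.isClosed_lattice.isOpen_compl
  have hcount : (L.lattice : Set ℂ).Countable := by
    have : Countable L.lattice := L.latticeEquivProd.toEquiv.countable_iff.2 inferInstance
    exact Set.countable_coe_iff.1 this
  have hconn : IsPreconnected ((L.lattice : Set ℂ)ᶜ) :=
    (hcount.isConnected_compl_of_one_lt_rank (by
      rw [Complex.rank_real_complex]
      norm_num)).isPreconnected
  have hA := L.analyticOnNhd_weierstrassP
  have hB := L.analyticOnNhd_derivWeierstrassP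
  have hd : ∀ z ∉ L.lattice, deriv L.derivWeierstrassP z = 6 * L.sumInvPow z 4 := by
    intro z hz
    have := L.deriv_derivWeierstrassPExcept_self z
    rwa [L.derivWeierstrassPExcept_of_notMem z hz] at this
  have hode : ∀ z ∈ (L.lattice : Set ℂ)ᶜ, L.derivWeierstrassP z *
      (2 * deriv L.derivWeierstrassP z - 12 * L.weierstrassP z ^ 2 + L.g₂) = 0 := by
    intro z hz
    have h1 : (fun z => L.derivWeierstrassP z ^ 2) =ᶠ[𝓝 z]
        fun z => 4 * L.weierstrassP z ^ 3 - L.g₂ * L.weierstrassP z - L.g₃ := by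
      filter_upwards [hopen.mem_nhds hz] with w hw using L.derivWeierstrassP_sq w hw
    have hP : HasDerivAt L.weierstrassP (L.derivWeierstrassP z) z := by
      rw [← L.deriv_weierstrassP]
      exact (hA z hz).differentiableAt.hasDerivAt
    have hP' : HasDerivAt L.derivWeierstrassP (deriv L.derivWeierstrassP z) z :=
      (hB z hz).differentiableAt.hasDerivAt
    have h2 := (hP'.pow 2).congr_of_eventuallyEq h1.symm
    have h3 := ((((hP.pow 3).const_mul 4).sub (hP.const_mul L.g₂)).sub_const L.g₃)
    have h4 := h2.unique h3
    simp only [Nat.cast_ofNat] at h4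
    linear_combination h4
  have hB' : AnalyticOnNhd ℂ (fun z => 2 * deriv L.derivWeierstrassP z -
      12 * L.weierstrassP z ^ 2 + L.g₂) (L.lattice : Set ℂ)ᶜ := fun z hz => by
    have h1 := hA z hz
    have h2 := (hB z hz).deriv
    fun_prop
  have hz := notMem_lattice p
  rcases AnalyticOnNhd.eq_zero_or_eq_zero_of_mul_eq_zero hB hB' hode hconn with h | h
  · -- `℘'` does not vanish identically as it has a pole
    exfalso
    have h1 : lead 3 (E 3) τ = 0 := by
      refine lead_eq (tendsto_const_nhds.congr fun z => ?_)
      by_cases hz : ((τ : ℂ), z) ∈ Set.range incl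
      · obtain ⟨q, hq⟩ := hz
        have hq1 : q.1.1 = τ := UpperHalfPlane.ext (congrArg Prod.fst hq)
        have h2 := E_three_eq_derivWeierstrassP q
        have h3 := notMem_lattice q
        rw [hq1] at h2 h3
        rw [h _ h3] at h2
        rw [← hq, ext0_incl]
        linear_combination z ^ 3 / 2 * h2
      · rw [ext0_of_notMem _ hz, mul_zero]
    exact one_ne_zero ((lead_E le_rfl τ).symm.trans h1)
  · have h1 := h _ hz
    rw [hd _ hz, ← E_four_eq_sumInvPow, ← wp_eq_weierstrassP] at h1
    linear_combination -h1

/-- The first order differential equation of `℘`, solved for `g₃`. -/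
lemma g₃_eq (p : Dom) : 12 * (wp p ^ 2 - E 4 p) * wp p + (periodPair p.1.1).g₃ =
    4 * wp p ^ 3 - 4 * E 3 p ^ 2 := by
  have h1 := (periodPair p.1.1).derivWeierstrassP_sq _ (notMem_lattice p)
  rw [← wp_eq_weierstrassP, ← E_three_eq_derivWeierstrassP, ← wp_sq_sub_E_four] at h1
  linear_combination h1

lemma G_eq_riemannZeta_mul_E {n : ℕ} (hn : 3 ≤ n) (τ : ℍ) :
    (periodPair τ).G n = 2 * riemannZeta n * ModularForm.E hn τ := by
  have h1 := tsum_eisSummand_eq_riemannZeta_mul_eisensteinSeries hn τ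
  have h2 : ModularForm.E hn τ =
      1 / 2 * eisensteinSeries (N := 1) 0 n τ := rfl
  have h3 : (periodPair τ).G n = ∑' v : Fin 2 → ℤ, EisensteinSeries.eisSummand n v τ := by
    rw [PeriodPair.G, tsum_lattice τ fun w => (w ^ n)⁻¹, ← (finTwoArrowEquiv ℤ).symm.tsum_eq]
    refine tsum_congr fun ω => ?_
    simp [EisensteinSeries.eisSummand]
  rw [h3, h1, h2]
  ring

lemma riemannZeta_natCast_ne_zero {n : ℕ} (hn : 3 ≤ n) : riemannZeta n ≠ 0 :=
  riemannZeta_ne_zero_of_one_lt_re (by simpa using by omega)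

lemma wp_sq_sub_E_four_mem_monomialSpan : wp ^ 2 - E 4 ∈ monomialSpan 4 := by
  have h := pow_mem_monomialSpan wp_mem_monomialSpan 2
  norm_num at h
  exact Submodule.sub_mem _ h E_four_mem_monomialSpan

/-- The constant of the differential equation of second order is proportional to `E₄`. -/
lemma E₄_mem_monomialSpan : (fun p : Dom => ModularForm.E₄ p.1.1) ∈ monomialSpan 4 := by
  have heq : (fun p : Dom => ModularForm.E₄ p.1.1) =
      (1 / (10 * riemannZeta (4 : ℕ))) • (wp ^ 2 - E 4) := by
    ext p
    have h1 := wp_sq_sub_E_four p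
    rw [PeriodPair.g₂, G_eq_riemannZeta_mul_E (by norm_num)] at h1
    have h2 := riemannZeta_natCast_ne_zero (n := 4) (by norm_num)
    simp only [Pi.smul_apply, Pi.sub_apply, Pi.pow_apply, smul_eq_mul]
    rw [one_div, eq_inv_mul_iff_mul_eq₀ (mul_ne_zero (by norm_num) h2)]
    linear_combination -h1 / 12
  rw [heq]
  exact Submodule.smul_mem _ _ wp_sq_sub_E_four_mem_monomialSpan

lemma E₆_mem_monomialSpan : (fun p : Dom => ModularForm.E₆ p.1.1) ∈ monomialSpan 6 := by
  have heq : (fun p : Dom => ModularForm.E₆ p.1.1) = (1 / (280 * riemannZeta (6 : ℕ))) •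
      ((4 : ℂ) • wp ^ 3 - (4 : ℂ) • E 3 ^ 2 - (12 : ℂ) • ((wp ^ 2 - E 4) * wp)) := by
    ext p
    have h1 := g₃_eq p
    rw [PeriodPair.g₃, G_eq_riemannZeta_mul_E (by norm_num)] at h1
    have h2 := riemannZeta_natCast_ne_zero (n := 6) (by norm_num)
    simp only [Pi.smul_apply, Pi.sub_apply, Pi.pow_apply, Pi.mul_apply, smul_eq_mul]
    rw [one_div, eq_inv_mul_iff_mul_eq₀ (mul_ne_zero (by norm_num) h2)]
    linear_combination h1
  have h1 := pow_mem_monomialSpan wp_mem_monomialSpan 3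
  have h2 := pow_mem_monomialSpan E_three_mem_monomialSpan 2
  have h3 := mul_mem_monomialSpan wp_sq_sub_E_four_mem_monomialSpan wp_mem_monomialSpan
  norm_num at h1 h2 h3
  rw [heq]
  exact Submodule.smul_mem _ _ (Submodule.sub_mem _ (Submodule.sub_mem _
    (Submodule.smul_mem _ _ h1) (Submodule.smul_mem _ _ h2)) (Submodule.smul_mem _ _ h3))

lemma discriminant_mem_monomialSpan :
    (fun p : Dom => ModularForm.discriminant p.1.1) ∈ monomialSpan 12 := by
  have heq : (fun p : Dom => ModularForm.discriminant p.1.1) = (1 / 1728 : ℂ) •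
      ((fun p : Dom => ModularForm.E₄ p.1.1) ^ 3 - (fun p : Dom => ModularForm.E₆ p.1.1) ^ 2) := by
    ext p
    rw [ModularForm.discriminant_eq_E₄_cube_sub_E₆_sq]
    simp only [Pi.smul_apply, Pi.sub_apply, Pi.pow_apply, smul_eq_mul]
    ring
  have h1 := pow_mem_monomialSpan E₄_mem_monomialSpan 3
  have h2 := pow_mem_monomialSpan E₆_mem_monomialSpan 2
  norm_num at h1 h2
  rw [heq]
  exact Submodule.smul_mem _ _ (Submodule.sub_mem _ h1 h2)

/-- A monomial in `E₄` and `E₆` has constant term `1`. -/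
lemma exists_modularForm_coeff_zero_eq_one (a b : ℕ) : ∃ g : ModularForm 𝒮ℒ (4 * a + 6 * b : ℤ),
    (qExpansion 1 g).coeff 0 = 1 ∧
      (fun p : Dom => g p.1.1) ∈ monomialSpan (4 * a + 6 * b) := by
  refine ⟨ModularForm.mcast (by ring) ((ModularForm.E₄.pow a).mul (ModularForm.E₆.pow b)), ?_, ?_⟩
  · rw [ModularForm.coe_mcast, ModularForm.qExpansion_mul one_pos one_mem_strictPeriods_SL,
      ModularForm.qExpansion_pow one_pos one_mem_strictPeriods_SL,
      ModularForm.qExpansion_pow one_pos one_mem_strictPeriods_SL]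
    have h4 := EisensteinSeries.E_qExpansion_coeff_zero (k := 4) (by norm_num) ⟨2, rfl⟩
    have h6 := EisensteinSeries.E_qExpansion_coeff_zero (k := 6) (by norm_num) ⟨3, rfl⟩
    rw [PowerSeries.coeff_zero_eq_constantCoeff] at h4 h6 ⊢
    rw [map_mul, map_pow, map_pow, h4, h6, one_pow, one_pow, one_mul]
  · have h := mul_mem_monomialSpan (pow_mem_monomialSpan E₄_mem_monomialSpan a)
      (pow_mem_monomialSpan E₆_mem_monomialSpan b)
    rw [mul_comm (a : ℤ), mul_comm (b : ℤ)] at h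
    convert h using 1
    ext p
    simp

lemma exists_four_mul_add_six_mul (k : ℤ) (h : 4 ≤ k) (hk : Even k) :
    ∃ a b : ℕ, (4 * a + 6 * b : ℤ) = k := by
  obtain ⟨m, rfl⟩ := hk
  lift m to ℕ using by omega
  rcases Nat.even_or_odd' m with ⟨n, rfl | rfl⟩
  · exact ⟨n, 0, by push_cast; ring⟩
  · obtain ⟨n, rfl⟩ : ∃ i, n = i + 1 := ⟨n - 1, by omega⟩
    exact ⟨n, 1, by push_cast; ring⟩

/-- Modular forms for `SL₂(ℤ)` are polynomials in `E₄` and `E₆`. -/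
theorem modularForm_mem_monomialSpan (F : ModularForm 𝒮ℒ k) :
    (fun p : Dom => F p.1.1) ∈ monomialSpan k := by
  obtain ⟨n, hn⟩ : ∃ n : ℕ, k < n := ⟨k.toNat + 1, by omega⟩
  induction n generalizing k with
  | zero =>
    have := ModularFormClass.levelOne_neg_weight_eq_zero (by simpa using hn) F
    simp only [this, Pi.zero_apply]
    exact Submodule.zero_mem _
  | succ n ih =>
    have hzero : ∀ {k : ℤ} (F : ModularForm 𝒮ℒ k), F = 0 →
        (fun p : Dom => F p.1.1) ∈ monomialSpan k := by
      rintro k _ rfl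
      exact Submodule.zero_mem _
    rcases Int.even_or_odd k with hk | hk
    swap
    · exact hzero F (ModularForm.levelOne_odd_weight_eq_zero hk F)
    rcases lt_or_ge k 0 with h0 | h0
    · have := ModularFormClass.levelOne_neg_weight_eq_zero h0 F
      simp only [this, Pi.zero_apply]
      exact Submodule.zero_mem _
    obtain rfl | rfl | h4 : k = 0 ∨ k = 2 ∨ 4 ≤ k := by
      obtain ⟨m, rfl⟩ := hk
      omega
    · obtain ⟨c, hc⟩ := ModularFormClass.levelOne_weight_zero_const F
      have := Submodule.smul_mem _ c one_mem_monomialSpan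
      simp only [hc, Function.const_apply]
      convert this using 1
      ext p
      simp
    · exact hzero F (rank_zero_iff_forall_zero.1 ModularForm.levelOne_weight_two_rank_zero F)
    · obtain ⟨a, b, rfl⟩ := exists_four_mul_add_six_mul k h4 hk
      obtain ⟨g, hg, hgm⟩ := exists_modularForm_coeff_zero_eq_one a b
      obtain ⟨G, hG⟩ := ModularForm.sub_smul_isCuspForm F g hg
      have h1 := ih (CuspForm.discriminantEquiv G) (by push_cast at hn; omega)
      have h2 := mul_mem_monomialSpan discriminant_mem_monomialSpan h1
      rw [add_sub_cancel] at h2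
      have h3 := Submodule.add_mem _ (Submodule.smul_mem _
        ((qExpansion 1 F).coeff 0) hgm) h2
      convert h3 using 1
      ext p
      have h5 : G p.1.1 = F p.1.1 - (qExpansion 1 F).coeff 0 * g p.1.1 := by
        exact DFunLike.congr_fun hG p.1.1
      simp only [Pi.add_apply, Pi.smul_apply, Pi.mul_apply, smul_eq_mul,
        ModularForm.discriminant_mul_discriminantEquiv_apply, h5]
      ring

/-! ### Lowering the order of the pole -/

lemma lead_mul (hf : ∀ p : Dom, DifferentiableAt ℂ (ext0 f) (incl p))
    (hg : ∀ p : Dom, DifferentiableAt ℂ (ext0 g) (incl p)) (hN : PoleLE N f τ)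
    (hM : PoleLE M g τ) : lead (N + M) (f * g) τ = lead N f τ * lead M g τ := by
  refine lead_eq (((hN.tendsto_lead hf).mul (hM.tendsto_lead hg)).congr fun z => ?_)
  rw [ext0_mul, Pi.mul_apply]
  ring

lemma lead_sub (hf : ∀ p : Dom, DifferentiableAt ℂ (ext0 f) (incl p))
    (hg : ∀ p : Dom, DifferentiableAt ℂ (ext0 g) (incl p)) (hN : PoleLE N f τ)
    (hM : PoleLE N g τ) : lead N (f - g) τ = lead N f τ - lead N g τ := by
  refine lead_eq (((hN.tendsto_lead hf).sub (hM.tendsto_lead hg)).congr fun z => ?_)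
  rw [ext0_sub, Pi.sub_apply]
  ring

lemma poleLE_comp_fst {F : ℍ → ℂ} (hF : Continuous F) (τ : ℍ) :
    PoleLE 0 (fun p : Dom => F p.1.1) τ := by
  have hc : ContinuousAt (fun x : ℂ × ℂ => F (ofComplex x.1)) ((τ : ℂ), 0) := by
    have h1 : ContinuousAt ofComplex (τ : ℂ) :=
      (contMDiffAt_ofComplex (n := 0) τ.im_pos).continuousAt
    have h2 : ContinuousAt (fun x : ℂ × ℂ => ofComplex x.1) ((τ : ℂ), 0) :=
      ContinuousAt.comp (g := ofComplex) (f := Prod.fst) h1 continuousAt_fst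
    exact hF.continuousAt.comp h2
  refine Asymptotics.IsBigO.trans (Asymptotics.IsBigO.of_bound 1 ?_) (hc.isBigO_one ℝ)
  refine Eventually.of_forall fun x => ?_
  by_cases hx : x ∈ Set.range incl
  · obtain ⟨p, rfl⟩ := hx
    rw [ext0_incl]
    simp [incl]
  · rw [ext0_of_notMem _ hx]
    simp

lemma lead_comp_fst (F : ℍ → ℂ) (τ : ℍ) : lead 0 (fun p : Dom => F p.1.1) τ = F τ := by
  refine lead_eq (tendsto_const_nhds.congr' ?_)
  have h1 : Tendsto (fun z : ℂ => ((τ : ℂ), z)) (𝓝[≠] 0) (𝓝 ((τ : ℂ), 0)) :=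
    ((by fun_prop : Continuous fun z : ℂ => ((τ : ℂ), z)).tendsto 0).mono_left nhdsWithin_le_nhds
  filter_upwards [h1.eventually (eventually_mem_range_incl τ), self_mem_nhdsWithin] with z hz hz0
  obtain ⟨p, hp⟩ := hz.2 hz0
  have hp1 : p.1.1 = τ := UpperHalfPlane.ext (congrArg Prod.fst hp)
  rw [← hp, ext0_incl, hp1, pow_zero, one_mul]

lemma isJacobiForm_wp_pow_mul_E_pow (i j : ℕ) :
    IsJacobiForm (i * 2 + j * 3) (wp ^ i * E 3 ^ j) :=
  (isJacobiForm_wp.pow i).mul ((isJacobiForm_E le_rfl).pow j)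

/-- `℘ ^ i E_3 ^ j` has a pole of order `2 i + 3 j` with leading coefficient `1`. -/
lemma poleLE_and_lead_pow (hf : IsJacobiForm k f) (hN : PoleLE N f τ) (h1 : lead N f τ = 1)
    (n : ℕ) : PoleLE (n * N) (f ^ n) τ ∧ lead (n * N) (f ^ n) τ = 1 := by
  induction n with
  | zero =>
    rw [zero_mul, pow_zero]
    exact ⟨poleLE_comp_fst (F := 1) continuous_const τ, lead_comp_fst 1 τ⟩
  | succ n ih =>
    rw [pow_succ, Nat.succ_mul]
    exact ⟨ih.1.mul hN, by
      rw [lead_mul (hf.pow n).meromorphic.holo hf.meromorphic.holo ih.1 hN, ih.2, h1, one_mul]⟩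

lemma poleLE_and_lead_wp_pow_mul_E_pow (i j : ℕ) (τ : ℍ) :
    PoleLE (i * 2 + j * 3) (wp ^ i * E 3 ^ j) τ ∧
      lead (i * 2 + j * 3) (wp ^ i * E 3 ^ j) τ = 1 := by
  have h1 := poleLE_and_lead_pow isJacobiForm_wp (poleLE_wp τ) (lead_wp τ) i
  have h2 := poleLE_and_lead_pow (isJacobiForm_E le_rfl) (poleLE_E le_rfl τ) (lead_E le_rfl τ) j
  refine ⟨h1.1.mul h2.1, ?_⟩
  rw [lead_mul (isJacobiForm_wp.pow i).meromorphic.holo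
    ((isJacobiForm_E le_rfl).pow j).meromorphic.holo h1.1 h2.1, h1.2, h2.2, one_mul]

lemma poleLE_of_forall_lead_eq_zero (hf : IsJacobiForm k f) (hN : ∀ τ, PoleLE (N + 1) f τ)
    (h0 : ∀ τ : ℍ, lead (N + 1) f τ = 0) (τ : ℍ) : PoleLE N f τ := by
  refine (hN τ).of_lead_eq_zero hf.meromorphic.holo ?_
  have : ∀ᶠ w : ℂ in 𝓝 (τ : ℂ), 0 < w.im :=
    (isOpen_lt continuous_const Complex.continuous_im).mem_nhds τ.im_pos
  exact this.mono fun w hw => h0 ⟨w, hw⟩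

/-- By induction on the order of the pole at `z = 0`: the leading coefficient is a modular form,
and it is removed by subtracting a multiple of `℘ ^ i E_3 ^ j`. -/
theorem mem_monomialSpan_of_poleLE (hf : IsJacobiForm k f) (hN : ∀ τ, PoleLE N f τ) :
    f ∈ monomialSpan k := by
  induction N generalizing f with
  | zero =>
    have h1 := modularForm_mem_monomialSpan (leadForm hf hN)
    have hk : monomialSpan (k - ((0 : ℕ) : ℤ)) = monomialSpan k := by rw [Nat.cast_zero, sub_zero]
    have heq : f = fun p => leadForm hf hN p.1.1 := ?_
    · rw [heq]
      exact hk.le h1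
    ext p
    rw [leadForm_apply]
    have := (hN p.1.1).eq_lead_zero hf.meromorphic.holo hf.elliptic (z := p.1.2) ⟨p, rfl⟩
    rw [← this]
    exact (ext0_incl f p).symm
  | succ N ih =>
    obtain rfl | hN1 := Nat.eq_zero_or_pos N
    · exact ih hf (poleLE_of_forall_lead_eq_zero hf hN fun τ =>
        lead_one_eq_zero hf.meromorphic.holo hf.elliptic (hN τ))
    obtain ⟨i, j, hij⟩ : ∃ i j : ℕ, i * 2 + j * 3 = N + 1 := by
      rcases Nat.even_or_odd' N with ⟨n, rfl | rfl⟩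
      · exact ⟨n - 1, 1, by omega⟩
      · exact ⟨n + 1, 0, by omega⟩
    set F := leadForm hf hN with hF
    set m : Dom → ℂ := fun p => F p.1.1 with hm
    have hmem : m * (wp ^ i * E 3 ^ j) ∈ monomialSpan k := by
      have h1 := wp_pow_mul_E_pow_mem_monomialSpan i j 0
      rw [pow_zero, mul_one] at h1
      have h2 := mul_mem_monomialSpan (modularForm_mem_monomialSpan F) h1
      have h3 : k - ((N + 1 : ℕ) : ℤ) + (2 * (i : ℤ) + 3 * j + 4 * ((0 : ℕ) : ℤ)) = k := by
        rw [← hij]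
        push_cast
        ring
      rwa [h3] at h2
    have hg : IsJacobiForm k (m * (wp ^ i * E 3 ^ j)) := monomialSpan_le_jacobiForms k hmem
    have hmJ := monomialSpan_le_jacobiForms _ (modularForm_mem_monomialSpan F)
    have hpole : ∀ τ, PoleLE (N + 1) (m * (wp ^ i * E 3 ^ j)) τ := fun τ => by
      have := (poleLE_comp_fst F.holo'.continuous τ).mul (poleLE_and_lead_wp_pow_mul_E_pow i j τ).1
      rwa [zero_add, hij] at this
    have hlead : ∀ τ : ℍ, lead (N + 1) (m * (wp ^ i * E 3 ^ j)) τ = lead (N + 1) f τ := fun τ => by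
      have h := poleLE_and_lead_wp_pow_mul_E_pow i j τ
      have := lead_mul hmJ.meromorphic.holo (isJacobiForm_wp_pow_mul_E_pow i j).meromorphic.holo
        (poleLE_comp_fst F.holo'.continuous τ) h.1
      rw [zero_add, h.2, mul_one, hij, lead_comp_fst] at this
      exact this
    have hsub : IsJacobiForm k (f - m * (wp ^ i * E 3 ^ j)) :=
      Submodule.sub_mem (jacobiForms k) hf hg
    have h1 := ih hsub (poleLE_of_forall_lead_eq_zero hsub (fun τ => (hN τ).sub (hpole τ))
      fun τ => by
        rw [lead_sub hf.meromorphic.holo hg.meromorphic.holo (hN τ) (hpole τ), hlead, sub_self])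
    have h2 := Submodule.add_mem _ h1 hmem
    rwa [sub_add_cancel] at h2

theorem jacobiForms_eq_monomialSpan (k : ℤ) : jacobiForms k = monomialSpan k := by
  refine le_antisymm (fun f (hf : IsJacobiForm k f) => ?_) (monomialSpan_le_jacobiForms k)
  obtain ⟨N, hN⟩ := hf.meromorphic.exists_forall_poleLE
  exact mem_monomialSpan_of_poleLE hf hN

end JacobiIndexZero

open JacobiIndexZero in
theorem mainTheorem8 :
    -- the three functions are Jacobi forms of index zero and weights 2, 3, 4
    ((E2 - e2) ∈ jacobiForms 2 ∧ E 3 ∈ jacobiForms 3 ∧ E 4 ∈ jacobiForms 4) ∧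
    -- every Jacobi form of weight t ≥ 2 is a polynomial, homogeneous of weight t, in them
    (∀ t : ℤ, 2 ≤ t → jacobiForms t = Submodule.span ℂ
      {f : Dom → ℂ | ∃ i j l : ℕ, (2 * i + 3 * j + 4 * l : ℤ) = t ∧
        f = (E2 - e2) ^ i * E 3 ^ j * E 4 ^ l}) ∧
    -- the algebra they generate is the algebra of Jacobi forms of index zero in weights ≥ 2
    -- (together with the constants)
    Subalgebra.toSubmodule (Algebra.adjoin ℂ ({E2 - e2, E 3, E 4} : Set (Dom → ℂ))) =
      Submodule.span ℂ {1} ⊔ ⨆ t : {t : ℤ // 2 ≤ t}, jacobiForms t := by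
  rw [E2_sub_e2]
  refine ⟨⟨isJacobiForm_wp, isJacobiForm_E le_rfl, isJacobiForm_E (by norm_num)⟩,
    fun t _ => jacobiForms_eq_monomialSpan t, le_antisymm ?_ (sup_le ?_ (iSup_le fun t => ?_))⟩
  · rw [Algebra.adjoin_eq_span, Submodule.span_le]
    intro f hf
    obtain ⟨i, j, l, rfl⟩ : ∃ i j l : ℕ, f = wp ^ i * E 3 ^ j * E 4 ^ l := by
      induction hf using Submonoid.closure_induction with
      | mem x hx =>
        rcases hx with rfl | rfl | rfl
        · exact ⟨1, 0, 0, by simp⟩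
        · exact ⟨0, 1, 0, by simp⟩
        · exact ⟨0, 0, 1, by simp⟩
      | one => exact ⟨0, 0, 0, by simp⟩
      | mul x y _ _ hx hy =>
        obtain ⟨a, b, c, rfl⟩ := hx
        obtain ⟨a', b', c', rfl⟩ := hy
        exact ⟨a + a', b + b', c + c', by ring⟩
    have hmem := monomialSpan_le_jacobiForms _ (wp_pow_mul_E_pow_mem_monomialSpan i j l)
    by_cases h : (2 : ℤ) ≤ 2 * i + 3 * j + 4 * l
    · exact le_sup_right (α := Submodule ℂ (Dom → ℂ))
        (le_iSup (fun t : {t : ℤ // 2 ≤ t} => jacobiForms t) ⟨_, h⟩ hmem)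
    -- The only monomial of weight less than `2` is `1`.
    · obtain ⟨rfl, rfl, rfl⟩ : i = 0 ∧ j = 0 ∧ l = 0 := by omega
      refine le_sup_left (α := Submodule ℂ (Dom → ℂ)) ?_
      simp
  · rw [Submodule.span_le, Set.singleton_subset_iff]
    exact one_mem (Algebra.adjoin ℂ _)
  · rw [jacobiForms_eq_monomialSpan, monomialSpan, Submodule.span_le]
    rintro _ ⟨i, j, l, -, rfl⟩
    have hsub : ∀ x ∈ ({wp, E 3, E 4} : Set (Dom → ℂ)), x ∈ Algebra.adjoin ℂ {wp, E 3, E 4} :=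
      fun x hx => Algebra.subset_adjoin hx
    change _ ∈ Algebra.adjoin ℂ _
    exact mul_mem (mul_mem (pow_mem (hsub _ (by simp)) i) (pow_mem (hsub _ (by simp)) j))
      (pow_mem (hsub _ (by simp)) l)
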